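/- **Setting.** RefHL has types $\tau ::= \mathtt{unit}\mid\mathtt{bool}\mid\tau+\tau\mid\tau\times\tau\mid\tau\to\tau\mid\mathtt{ref}\,\tau$ and expressions $()$, true, false, variables, inl, inr, pairs, fst, snd, if, $\lambda x{:}\tau.e$, application, match, ref, $!e$, $e:=e$; RefLL has types $\tau ::= \mathtt{int}\mid[\tau]\mid\tau\to\tau\mid\mathtt{ref}\,\tau$ and expressions $n\in\mathbb Z$, variables, array literals $[e_1,\dots,e_n]$, $e[e]$, $\lambda x{:}\tau.e$, application, $e+e$, if0, ref, $!e$, $e:=e$. Variables of the two languages are distinct. Each language also has a boundary form $(\!|e|\!)_\tau$ embedding a term $e$ of the other language at type $\tau$. Typing judgments carry an environment for each language; the rules are the standard ones (an assignment has type $\mathtt{unit}$ in RefHL and $\mathtt{int}$ in RefLL), and $(\!|e|\!)_\tau$ has type $\tau$ when $e$ has a type convertible with $\tau$. Convertibility $\tau_A\sim\tau_B$ is generated by: $\mathtt{bool}\sim\mathtt{int}$; $\mathtt{ref\,bool}\sim\mathtt{ref\,int}$; $\tau_1+\tau_2\sim[\mathtt{int}]$ if $\tau_1\sim\mathtt{int}$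 and $\tau_2\sim\mathtt{int}$; $\tau_1\times\tau_2\sim[\tau]$ if $\tau_1\sim\tau$ and $\tau_2\sim\tau$. **Target.** StackLang has values $v ::= n\mid \mathsf{thunk}\,P\mid \ell\mid[v,\dots]$ and programs $P$ that are finite sequences of the instructions push $v$, add, less?, if0 $P\,P$, lam $x.P$, call, idx, len, alloc, read, write, fail $c$, with $c\in\{\mathrm{Type},\mathrm{Idx},\mathrm{Conv}\}$. Configurations $\langle H;S;P\rangle$ consist of a finite heap $H$ mapping locations to values, a stack $S$ (a sequence of values, or $\mathsf{Fail}\,c$), and a program $P$. The step relation $\to$ is the usual one for these instructions. In particular alloc chooses any fresh location; an index out of bounds leads to the program fail Idx; an instruction whose precondition on the shape of the stack is not met leads to the program fail Type; $\langle H;S;\mathsf{fail}\,c,P\rangle\to\langle H;\mathsf{Fail}\,c;\cdot\rangle$; and there is no step from the empty program, from reading or writing a location outside the heap, or from pushing an unbound variable. **Compilation.** A well-typed term $e$ compiles to a StackLang program $e^+$: unit is $0$; true and false are $0$ and $1$ (if0 branches on $0$ versus nonzero); inl and inr build the arrays $[0,v]$ and $[1,v]$; pairs and arrays become arrays; $\lambda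 x.e$ becomes $\mathsf{push}\,(\mathsf{thunk}\,\mathsf{lam}\,x.e^+)$; reference operations become alloc, read, write (an assignment returns $0$). A boundary compiles to the code of the embedded term followed by glue code. The glue code for $\mathtt{bool}\sim\mathtt{int}$ and $\mathtt{ref\,bool}\sim\mathtt{ref\,int}$ is empty; for sums and products it converts the components, and from arrays to sums or products it first fails with Conv if the array has fewer than two entries, and for sums also if the tag is neither $0$ nor $1$. (Since the glue code depends on the type of the embedded term, $e^+$ is defined from a typing derivation of $e$; the theorem holds for every derivation.) **Theorem 3.4 (Type Safety for RefHL).** Let $e$ be a closed RefHL expression, possibly containing RefLL code behind boundaries, with $\cdot;\cdot\vdash e:\tau$. Then for every finite heap $H$, if $$\langle H;\cdot;e^+\rangle\to^*\langle H';S';P'\rangle,$$ then either $\langle H';S';P'\rangle\to\langle H'';S'';P''\rangle$ for some $H'',S'',P''$, or $P'=\cdot$ and either $S'=\mathsf{Fail}\,c$ for some $c\in\{\mathrm{Conv},\mathrm{Idx}\}$ or $S'=v$ (the stack consists of exactly one closed value $v$). -/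

import Mathlib

namespace RefLang

/-! ## The target language StackLang -/

/-- Target variables. Variables of the two source languages live in disjoint name spaces, and
`tmp` supplies the bound names used by the macros and the glue code. -/
inductive TVar where
  | hl (x : ℕ)
  | ll (x : ℕ)
  | tmp (i : ℕ)
deriving DecidableEq

/-- Error codes `Type`, `Idx`, `Conv`. -/
inductive Err where
  | typeErr
  | idxErr
  | convErr

mutual
  /-- Value expressions: integers, suspended programs, locations, arrays of values, and
  (only inside code, as placeholders for substitution) variables. -/
  inductive Val where
    | num (n : ℤ)
    | thunk (P : List Instr)
    | loc (l : ℕ)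
    | arr (vs : List Val)
    | var (x : TVar)
  /-- Instructions. -/
  inductive Instr where
    | push (v : Val)
    | add
    | less
    | if0 (P₁ P₂ : List Instr)
    | lam (x : TVar) (P : List Instr)
    | call
    | idx
    | len
    | alloc
    | read
    | write
    | fail (c : Err)
end

/-- Programs are finite sequences of instructions; `[]` is the empty program. -/
abbrev Prog := List Instr

/-! Substitution `[x ↦ v]`. The only binder is `lam`. The machine substitutes closed values
into closed programs, so no renaming of bound variables is needed. -/

mutual
  def Val.subst (x : TVar) (v : Val) : Val → Val
    | .num n => .num n
    | .thunk P => .thunk (Prog.subst x v P)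
    | .loc l => .loc l
    | .arr vs => .arr (Vals.subst x v vs)
    | .var y => if y = x then v else .var y
  def Vals.subst (x : TVar) (v : Val) : List Val → List Val
    | [] => []
    | w :: ws => Val.subst x v w :: Vals.subst x v ws
  def Instr.subst (x : TVar) (v : Val) : Instr → Instr
    | .push w => .push (Val.subst x v w)
    | .if0 P₁ P₂ => .if0 (Prog.subst x v P₁) (Prog.subst x v P₂)
    | .lam y P => if y = x then .lam y P else .lam y (Prog.subst x v P)
    | .add => .add
    | .less => .less
    | .call => .call
    | .idx => .idx
    | .len => .len
    | .alloc => .alloc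
    | .read => .read
    | .write => .write
    | .fail c => .fail c
  def Prog.subst (x : TVar) (v : Val) : List Instr → List Instr
    | [] => []
    | i :: P => Instr.subst x v i :: Prog.subst x v P
end

/-! `ClosedIn B`: every free variable belongs to `B`. -/

mutual
  def Val.ClosedIn (B : Set TVar) : Val → Prop
    | .num _ => True
    | .thunk P => Prog.ClosedIn B P
    | .loc _ => True
    | .arr vs => Vals.ClosedIn B vs
    | .var y => y ∈ B
  def Vals.ClosedIn (B : Set TVar) : List Val → Prop
    | [] => True
    | w :: ws => Val.ClosedIn B w ∧ Vals.ClosedIn B ws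
  def Instr.ClosedIn (B : Set TVar) : Instr → Prop
    | .push w => Val.ClosedIn B w
    | .if0 P₁ P₂ => Prog.ClosedIn B P₁ ∧ Prog.ClosedIn B P₂
    | .lam y P => Prog.ClosedIn (insert y B) P
    | .add => True
    | .less => True
    | .call => True
    | .idx => True
    | .len => True
    | .alloc => True
    | .read => True
    | .write => True
    | .fail _ => True
  def Prog.ClosedIn (B : Set TVar) : List Instr → Prop
    | [] => True
    | i :: P => Instr.ClosedIn B i ∧ Prog.ClosedIn B P
end

/-- A value proper: a value expression without free variables. -/
def Val.Closed (v : Val) : Prop := v.ClosedIn ∅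

/-- Heaps are finite maps from locations to values. -/
abbrev Heap := Finmap (fun _ : ℕ => Val)

/-- Stacks: a list of values (the top of the stack is the head of the list), or `Fail c`. -/
inductive Stack where
  | ok (vs : List Val)
  | fail (c : Err)

/-- Machine configurations `⟨H; S; P⟩`. -/
structure Config where
  heap : Heap
  stack : Stack
  prog : Prog

/-- The precondition of an instruction on the shape of the stack. -/
def Instr.StackOk : Instr → Stack → Prop
  | .push _, .ok _ => True
  | .add, .ok (.num _ :: .num _ :: _) => True
  | .less, .ok (.num _ :: .num _ :: _) => True
  | .if0 _ _, .ok (.num _ :: _) => True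
  | .lam _ _, .ok (_ :: _) => True
  | .call, .ok (.thunk _ :: _) => True
  | .idx, .ok (.num _ :: .arr _ :: _) => True
  | .len, .ok (.arr _ :: _) => True
  | .alloc, .ok (_ :: _) => True
  | .read, .ok (.loc _ :: _) => True
  | .write, .ok (_ :: .loc _ :: _) => True
  | .fail _, _ => True
  | _, _ => False

/-- Small-step semantics. Whenever the stack precondition of the next instruction is not met, the
configuration steps to the program `fail Type`. There is no rule for the empty program, for
reading or writing a location outside the heap, or for pushing an unbound variable: such
configurations are irreducible. -/
inductive Step : Config → Config → Prop where
  | push {H S v P} : v.Closed →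
      Step ⟨H, .ok S, .push v :: P⟩ ⟨H, .ok (v :: S), P⟩
  | add {H S P} {n n' : ℤ} :
      Step ⟨H, .ok (.num n :: .num n' :: S), .add :: P⟩ ⟨H, .ok (.num (n + n') :: S), P⟩
  | less {H S P} {n n' : ℤ} :
      Step ⟨H, .ok (.num n :: .num n' :: S), .less :: P⟩
        ⟨H, .ok (.num (if n < n' then 0 else 1) :: S), P⟩
  | if0 {H S P P₁ P₂} {n : ℤ} :
      Step ⟨H, .ok (.num n :: S), .if0 P₁ P₂ :: P⟩
        ⟨H, .ok S, (if n = 0 then P₁ else P₂) ++ P⟩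
  | lam {H S v x P₁ P₂} :
      Step ⟨H, .ok (v :: S), .lam x P₁ :: P₂⟩ ⟨H, .ok S, Prog.subst x v P₁ ++ P₂⟩
  | call {H S P₁ P₂} :
      Step ⟨H, .ok (.thunk P₁ :: S), .call :: P₂⟩ ⟨H, .ok S, P₁ ++ P₂⟩
  | idx {H S P vs v} {n : ℤ} : 0 ≤ n → vs[n.toNat]? = some v →
      Step ⟨H, .ok (.num n :: .arr vs :: S), .idx :: P⟩ ⟨H, .ok (v :: S), P⟩
  | idxFail {H S P vs} {n : ℤ} : (n < 0 ∨ (vs.length : ℤ) ≤ n) →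
      Step ⟨H, .ok (.num n :: .arr vs :: S), .idx :: P⟩ ⟨H, .ok S, [.fail .idxErr]⟩
  | len {H S P vs} :
      Step ⟨H, .ok (.arr vs :: S), .len :: P⟩ ⟨H, .ok (.num (vs.length : ℤ) :: S), P⟩
  | alloc {H S v l P} : l ∉ H →
      Step ⟨H, .ok (v :: S), .alloc :: P⟩ ⟨H.insert l v, .ok (.loc l :: S), P⟩
  | read {H S v l P} : H.lookup l = some v →
      Step ⟨H, .ok (.loc l :: S), .read :: P⟩ ⟨H, .ok (v :: S), P⟩
  | write {H S v l P} : l ∈ H →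
      Step ⟨H, .ok (v :: .loc l :: S), .write :: P⟩ ⟨H.insert l v, .ok S, P⟩
  | fail {H S c P} : Step ⟨H, S, .fail c :: P⟩ ⟨H, .fail c, []⟩
  | typeFail {H S i P} : ¬ i.StackOk S → Step ⟨H, S, i :: P⟩ ⟨H, S, [.fail .typeErr]⟩

/-- Reachability: zero or more steps. -/
abbrev Steps : Config → Config → Prop := Relation.ReflTransGen Step

/-! ## Source syntax -/

/-- RefHL types. -/
inductive HLType where
  | unit
  | bool
  | sum (τ₁ τ₂ : HLType)
  | prod (τ₁ τ₂ : HLType)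
  | fn (τ₁ τ₂ : HLType)
  | ref (τ : HLType)

/-- RefLL types. -/
inductive LLType where
  | int
  | arr (τ : LLType)
  | fn (τ₁ τ₂ : LLType)
  | ref (τ : LLType)

mutual
  /-- RefHL expressions; `boundary τ e` embeds the RefLL expression `e` at type `τ`. -/
  inductive HLExpr where
    | unit
    | tt
    | ff
    | var (x : ℕ)
    | inl (e : HLExpr)
    | inr (e : HLExpr)
    | pair (e₁ e₂ : HLExpr)
    | fst (e : HLExpr)
    | snd (e : HLExpr)
    | ite (e e₁ e₂ : HLExpr)
    | lam (x : ℕ) (τ : HLType) (e : HLExpr)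
    | app (e₁ e₂ : HLExpr)
    | case (e : HLExpr) (x : ℕ) (e₁ : HLExpr) (y : ℕ) (e₂ : HLExpr)
    | ref (e : HLExpr)
    | deref (e : HLExpr)
    | assign (e₁ e₂ : HLExpr)
    | boundary (τ : HLType) (e : LLExpr)
  /-- RefLL expressions; `boundary τ e` embeds the RefHL expression `e` at type `τ`. -/
  inductive LLExpr where
    | num (n : ℤ)
    | var (x : ℕ)
    | arr (es : List LLExpr)
    | idx (e₁ e₂ : LLExpr)
    | lam (x : ℕ) (τ : LLType) (e : LLExpr)
    | app (e₁ e₂ : LLExpr)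
    | add (e₁ e₂ : LLExpr)
    | if0 (e e₁ e₂ : LLExpr)
    | ref (e : LLExpr)
    | deref (e : LLExpr)
    | assign (e₁ e₂ : LLExpr)
    | boundary (τ : LLType) (e : HLExpr)
end

/-! ## Convertibility and glue code -/

/-- The convertibility judgment `τA ∼ τB`. -/
inductive Conv : HLType → LLType → Type where
  | bool : Conv .bool .int
  | refBool : Conv (.ref .bool) (.ref .int)
  | sum {τ₁ τ₂} (c₁ : Conv τ₁ .int) (c₂ : Conv τ₂ .int) : Conv (.sum τ₁ τ₂) (.arr .int)
  | prod {τ₁ τ₂ τ} (c₁ : Conv τ₁ τ) (c₂ : Conv τ₂ τ) : Conv (.prod τ₁ τ₂) (.arr τ)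

/-- Macro `SWAP ≜ lam x. (lam y. push x, push y)`. -/
def SWAP : Instr :=
  .lam (.tmp 0) [.lam (.tmp 1) [.push (.var (.tmp 0)), .push (.var (.tmp 1))]]

/-- Macro `DUP ≜ lam x. (push x, push x)`. -/
def DUP : Instr :=
  .lam (.tmp 0) [.push (.var (.tmp 0)), .push (.var (.tmp 0))]

/-- `lam x₂. lam x₁. push [x₁, x₂]`: replaces the two topmost values by an array. -/
def PAIR : Instr :=
  .lam (.tmp 1) [.lam (.tmp 0) [.push (.arr [.var (.tmp 0), .var (.tmp 1)])]]

/-- Fails with `Conv` if the array on top of the stack has fewer than two entries. -/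
def CHECK2 : Prog :=
  [DUP, .len, .push (.num 2), SWAP, .less, .if0 [.fail .convErr] []]

/-- Replaces the array `[t, v, …]` on top of the stack by `v`, and `t` on top of it. -/
def UNTAG : Prog :=
  [DUP, .push (.num 1), .idx, SWAP, .push (.num 0), .idx]

/-- The glue code from `τA` to `τB`. -/
def Conv.toLL : {τA : HLType} → {τB : LLType} → Conv τA τB → Prog
  | _, _, .bool => []
  | _, _, .refBool => []
  | _, _, .sum c₁ c₂ =>
      UNTAG ++ [DUP, .if0 (SWAP :: c₁.toLL) (SWAP :: c₂.toLL), PAIR]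
  | _, _, .prod c₁ c₂ =>
      [DUP, .push (.num 0), .idx] ++ c₁.toLL ++ [SWAP, .push (.num 1), .idx] ++ c₂.toLL ++ [PAIR]

/-- The glue code from `τB` to `τA`. -/
def Conv.toHL : {τA : HLType} → {τB : LLType} → Conv τA τB → Prog
  | _, _, .bool => []
  | _, _, .refBool => []
  | _, _, .sum c₁ c₂ =>
      CHECK2 ++ UNTAG ++
        [DUP, .if0 (SWAP :: c₁.toHL)
          [DUP, .push (.num (-1)), .add, .if0 (SWAP :: c₂.toHL) [.fail .convErr]], PAIR]
  | _, _, .prod c₁ c₂ =>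
      CHECK2 ++
        [DUP, .push (.num 0), .idx] ++ c₁.toHL ++ [SWAP, .push (.num 1), .idx] ++ c₂.toHL ++ [PAIR]

/-! ## Static semantics

A derivation of a typing judgment is data, because the glue code at a boundary is selected by the
type at which the embedded term has been typed. A judgment holds if it has a derivation. -/

/-- Typing environments of RefHL. -/
abbrev HLCtx := ℕ → Option HLType

/-- Typing environments of RefLL. -/
abbrev LLCtx := ℕ → Option LLType

/-- The environment extended by `x : τ`, which hides an earlier binding of `x`. -/
def extend {T : Type} (Γ : ℕ → Option T) (x : ℕ) (τ : T) : ℕ → Option T :=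
  Function.update Γ x (some τ)

mutual
  /-- Derivations of `Γ_LL; Γ_HL ⊢ e : τ` for RefHL. -/
  inductive HLTyping : LLCtx → HLCtx → HLExpr → HLType → Type where
    | unit {Δ Γ} : HLTyping Δ Γ .unit .unit
    | tt {Δ Γ} : HLTyping Δ Γ .tt .bool
    | ff {Δ Γ} : HLTyping Δ Γ .ff .bool
    | var {Δ Γ x τ} : Γ x = some τ → HLTyping Δ Γ (.var x) τ
    | inl {Δ Γ e τ₁ τ₂} : HLTyping Δ Γ e τ₁ → HLTyping Δ Γ (.inl e) (.sum τ₁ τ₂)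
    | inr {Δ Γ e τ₁ τ₂} : HLTyping Δ Γ e τ₂ → HLTyping Δ Γ (.inr e) (.sum τ₁ τ₂)
    | pair {Δ Γ e₁ e₂ τ₁ τ₂} : HLTyping Δ Γ e₁ τ₁ → HLTyping Δ Γ e₂ τ₂ →
        HLTyping Δ Γ (.pair e₁ e₂) (.prod τ₁ τ₂)
    | fst {Δ Γ e τ₁ τ₂} : HLTyping Δ Γ e (.prod τ₁ τ₂) → HLTyping Δ Γ (.fst e) τ₁
    | snd {Δ Γ e τ₁ τ₂} : HLTyping Δ Γ e (.prod τ₁ τ₂) → HLTyping Δ Γ (.snd e) τ₂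
    | ite {Δ Γ e e₁ e₂ τ} : HLTyping Δ Γ e .bool → HLTyping Δ Γ e₁ τ → HLTyping Δ Γ e₂ τ →
        HLTyping Δ Γ (.ite e e₁ e₂) τ
    | lam {Δ Γ x e τ₁ τ₂} : HLTyping Δ (extend Γ x τ₁) e τ₂ →
        HLTyping Δ Γ (.lam x τ₁ e) (.fn τ₁ τ₂)
    | app {Δ Γ e₁ e₂ τ₁ τ₂} : HLTyping Δ Γ e₁ (.fn τ₁ τ₂) → HLTyping Δ Γ e₂ τ₁ →
        HLTyping Δ Γ (.app e₁ e₂) τ₂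
    | case {Δ Γ e x e₁ y e₂ τ₁ τ₂ τ} : HLTyping Δ Γ e (.sum τ₁ τ₂) →
        HLTyping Δ (extend Γ x τ₁) e₁ τ → HLTyping Δ (extend Γ y τ₂) e₂ τ →
        HLTyping Δ Γ (.case e x e₁ y e₂) τ
    | ref {Δ Γ e τ} : HLTyping Δ Γ e τ → HLTyping Δ Γ (.ref e) (.ref τ)
    | deref {Δ Γ e τ} : HLTyping Δ Γ e (.ref τ) → HLTyping Δ Γ (.deref e) τ
    | assign {Δ Γ e₁ e₂ τ} : HLTyping Δ Γ e₁ (.ref τ) → HLTyping Δ Γ e₂ τ →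
        HLTyping Δ Γ (.assign e₁ e₂) .unit
    | boundary {Δ Γ e τA τB} : LLTyping Γ Δ e τB → Conv τA τB →
        HLTyping Δ Γ (.boundary τA e) τA
  /-- Derivations of `Γ_HL; Γ_LL ⊢ e : τ` for RefLL. -/
  inductive LLTyping : HLCtx → LLCtx → LLExpr → LLType → Type where
    | num {Γ Δ n} : LLTyping Γ Δ (.num n) .int
    | var {Γ Δ x τ} : Δ x = some τ → LLTyping Γ Δ (.var x) τ
    | arr {Γ Δ es τ} : LLTypings Γ Δ es τ → LLTyping Γ Δ (.arr es) (.arr τ)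
    | idx {Γ Δ e₁ e₂ τ} : LLTyping Γ Δ e₁ (.arr τ) → LLTyping Γ Δ e₂ .int →
        LLTyping Γ Δ (.idx e₁ e₂) τ
    | lam {Γ Δ x e τ₁ τ₂} : LLTyping Γ (extend Δ x τ₁) e τ₂ →
        LLTyping Γ Δ (.lam x τ₁ e) (.fn τ₁ τ₂)
    | app {Γ Δ e₁ e₂ τ₁ τ₂} : LLTyping Γ Δ e₁ (.fn τ₁ τ₂) → LLTyping Γ Δ e₂ τ₁ →
        LLTyping Γ Δ (.app e₁ e₂) τ₂
    | add {Γ Δ e₁ e₂} : LLTyping Γ Δ e₁ .int → LLTyping Γ Δ e₂ .int →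
        LLTyping Γ Δ (.add e₁ e₂) .int
    | if0 {Γ Δ e e₁ e₂ τ} : LLTyping Γ Δ e .int → LLTyping Γ Δ e₁ τ → LLTyping Γ Δ e₂ τ →
        LLTyping Γ Δ (.if0 e e₁ e₂) τ
    | ref {Γ Δ e τ} : LLTyping Γ Δ e τ → LLTyping Γ Δ (.ref e) (.ref τ)
    | deref {Γ Δ e τ} : LLTyping Γ Δ e (.ref τ) → LLTyping Γ Δ (.deref e) τ
    | assign {Γ Δ e₁ e₂ τ} : LLTyping Γ Δ e₁ (.ref τ) → LLTyping Γ Δ e₂ τ →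
        LLTyping Γ Δ (.assign e₁ e₂) .int
    | boundary {Γ Δ e τA τB} : HLTyping Δ Γ e τA → Conv τA τB →
        LLTyping Γ Δ (.boundary τB e) τB
  /-- All entries of an array literal have the same type. -/
  inductive LLTypings : HLCtx → LLCtx → List LLExpr → LLType → Type where
    | nil {Γ Δ τ} : LLTypings Γ Δ [] τ
    | cons {Γ Δ e es τ} : LLTyping Γ Δ e τ → LLTypings Γ Δ es τ → LLTypings Γ Δ (e :: es) τ
end

/-! ## Compilation -/

/-- `lam x_{n-1}. … lam x_0. P`. -/
def bindTmps : ℕ → Prog → Prog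
  | 0, P => P
  | n + 1, P => [.lam (.tmp n) (bindTmps n P)]

/-- `lam x_{n-1}. … lam x_0. push [x_0, …, x_{n-1}]`. -/
def mkArr (n : ℕ) : Prog :=
  bindTmps n [.push (.arr ((List.range n).map fun i => .var (.tmp i)))]

mutual
  /-- The compiled program of a (typed) RefHL expression. -/
  def HLTyping.compile : {Δ : LLCtx} → {Γ : HLCtx} → {e : HLExpr} → {τ : HLType} →
      HLTyping Δ Γ e τ → Prog
    | _, _, _, _, .unit => [.push (.num 0)]
    | _, _, _, _, .tt => [.push (.num 0)]
    | _, _, _, _, .ff => [.push (.num 1)]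
    | _, _, _, _, .var (x := x) _ => [.push (.var (.hl x))]
    | _, _, _, _, .inl D =>
        D.compile ++ [.lam (.tmp 0) [.push (.arr [.num 0, .var (.tmp 0)])]]
    | _, _, _, _, .inr D =>
        D.compile ++ [.lam (.tmp 0) [.push (.arr [.num 1, .var (.tmp 0)])]]
    | _, _, _, _, .pair D₁ D₂ => D₁.compile ++ D₂.compile ++ [PAIR]
    | _, _, _, _, .fst D => D.compile ++ [.push (.num 0), .idx]
    | _, _, _, _, .snd D => D.compile ++ [.push (.num 1), .idx]
    | _, _, _, _, .ite D D₁ D₂ => D.compile ++ [.if0 D₁.compile D₂.compile]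
    | _, _, _, _, .lam (x := x) D => [.push (.thunk [.lam (.hl x) D.compile])]
    | _, _, _, _, .app D₁ D₂ => D₁.compile ++ D₂.compile ++ [SWAP, .call]
    | _, _, _, _, .case (x := x) (y := y) D D₁ D₂ =>
        D.compile ++ UNTAG ++ [.if0 [.lam (.hl x) D₁.compile] [.lam (.hl y) D₂.compile]]
    | _, _, _, _, .ref D => D.compile ++ [.alloc]
    | _, _, _, _, .deref D => D.compile ++ [.read]
    | _, _, _, _, .assign D₁ D₂ => D₁.compile ++ D₂.compile ++ [.write, .push (.num 0)]
    | _, _, _, _, .boundary D c => D.compile ++ c.toHL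
  /-- The compiled program of a (typed) RefLL expression. -/
  def LLTyping.compile : {Γ : HLCtx} → {Δ : LLCtx} → {e : LLExpr} → {τ : LLType} →
      LLTyping Γ Δ e τ → Prog
    | _, _, _, _, .num (n := n) => [.push (.num n)]
    | _, _, _, _, .var (x := x) _ => [.push (.var (.ll x))]
    | _, _, _, _, .arr (es := es) Ds => Ds.compile ++ mkArr es.length
    | _, _, _, _, .idx D₁ D₂ => D₁.compile ++ D₂.compile ++ [.idx]
    | _, _, _, _, .lam (x := x) D => [.push (.thunk [.lam (.ll x) D.compile])]
    | _, _, _, _, .app D₁ D₂ => D₁.compile ++ D₂.compile ++ [SWAP, .call]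
    | _, _, _, _, .add D₁ D₂ => D₁.compile ++ D₂.compile ++ [SWAP, .add]
    | _, _, _, _, .if0 D D₁ D₂ => D.compile ++ [.if0 D₁.compile D₂.compile]
    | _, _, _, _, .ref D => D.compile ++ [.alloc]
    | _, _, _, _, .deref D => D.compile ++ [.read]
    | _, _, _, _, .assign D₁ D₂ => D₁.compile ++ D₂.compile ++ [.write, .push (.num 0)]
    | _, _, _, _, .boundary D c => D.compile ++ c.toLL
  /-- The entries of an array literal, evaluated from left to right. -/
  def LLTypings.compile : {Γ : HLCtx} → {Δ : LLCtx} → {es : List LLExpr} → {τ : LLType} →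
      LLTypings Γ Δ es τ → Prog
    | _, _, _, _, .nil => []
    | _, _, _, _, .cons D Ds => D.compile ++ Ds.compile
end

end RefLang

namespace RefLang

/-! ## Simultaneous substitution -/

-- The types of both languages are interpreted in one step-indexed Kripke logical relation on target
-- values. Since `unit`, `bool` and `int` become a single target type, `ref bool` and `ref int` have
-- the same interpretation, and empty glue code at references is sound: both languages see one cell
-- with one prescribed type. A world assigns to a location a type and not a set of values, so worlds
-- themselves involve no circularity; the circularity between functions and the heap is broken by
-- the step index.
--
-- A stack program always runs in front of some remaining code, so the relation has
-- continuation-passing form: a program is good at type `T` if it is safe when followed by any code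
-- that is safe on receiving a value of type `T` (`SemTyped`, `ContRel`). Safety is closed under
-- taking smaller indices, hence every instruction may be treated as free of charge except `call`,
-- where the function clause of `ValRel` demands a strictly smaller index.
--
-- The weight is carried by `ValRel.mono` and `HeapRel.alloc` (stability under allocation),
-- `Conv.safe_toLL` and `Conv.safe_toHL` (the glue code converts related values), and the mutual
-- induction `HLTyping.sound` over typing derivations. Type safety is the instance with the empty
-- world, which asks nothing of the initial heap, and the empty continuation, which is final on a
-- single closed value.

/-- Closing substitutions: partial maps from variables to values. -/
abbrev Env := TVar → Option Val

mutual
  def Val.msubst (γ : Env) : Val → Val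
    | .num n => .num n
    | .thunk P => .thunk (Prog.msubst γ P)
    | .loc l => .loc l
    | .arr vs => .arr (Vals.msubst γ vs)
    | .var y => (γ y).getD (.var y)
  def Vals.msubst (γ : Env) : List Val → List Val
    | [] => []
    | w :: ws => Val.msubst γ w :: Vals.msubst γ ws
  def Instr.msubst (γ : Env) : Instr → Instr
    | .push w => .push (Val.msubst γ w)
    | .if0 P₁ P₂ => .if0 (Prog.msubst γ P₁) (Prog.msubst γ P₂)
    -- The bound variable leaves the domain; capture cannot occur because only closed values are
    -- substituted.
    | .lam y P => .lam y (Prog.msubst (Function.update γ y none) P)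
    | .add => .add
    | .less => .less
    | .call => .call
    | .idx => .idx
    | .len => .len
    | .alloc => .alloc
    | .read => .read
    | .write => .write
    | .fail c => .fail c
  def Prog.msubst (γ : Env) : List Instr → List Instr
    | [] => []
    | i :: P => Instr.msubst γ i :: Prog.msubst γ P
end

/-- All values of the substitution are closed. -/
def Env.Closed (γ : Env) : Prop := ∀ y v, γ y = some v → v.Closed

theorem Env.Closed.update_none {γ : Env} (h : γ.Closed) (x : TVar) :
    Env.Closed (Function.update γ x none) := by
  intro y v hy
  by_cases hyx : y = x
  · subst hyx; simp at hy
  · rw [Function.update_of_ne hyx] at hy; exact h y v hy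

theorem Env.Closed.update_some {γ : Env} (h : γ.Closed) (x : TVar) {w : Val} (hw : w.Closed) :
    Env.Closed (Function.update γ x (some w)) := by
  intro y v hy
  by_cases hyx : y = x
  · subst hyx; simp at hy; exact hy ▸ hw
  · rw [Function.update_of_ne hyx] at hy; exact h y v hy

theorem Prog.msubst_append (γ : Env) (P Q : Prog) :
    Prog.msubst γ (P ++ Q) = Prog.msubst γ P ++ Prog.msubst γ Q := by
  induction P with
  | nil => rfl
  | cons i P ih => simp [Prog.msubst, ih]

theorem Prog.closedIn_append (B : Set TVar) (P Q : Prog) :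
    Prog.ClosedIn B (P ++ Q) ↔ Prog.ClosedIn B P ∧ Prog.ClosedIn B Q := by
  induction P with
  | nil => simp [Prog.ClosedIn]
  | cons i P ih => simp [Prog.ClosedIn, ih, and_assoc]

theorem Vals.subst_eq_map (x : TVar) (v : Val) (ws : List Val) :
    Vals.subst x v ws = ws.map (Val.subst x v) := by
  induction ws with
  | nil => rfl
  | cons w ws ih => simp [Vals.subst, ih]

theorem Vals.closedIn_iff (B : Set TVar) (ws : List Val) :
    Vals.ClosedIn B ws ↔ ∀ w ∈ ws, w.ClosedIn B := by
  induction ws with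
  | nil => simp [Vals.ClosedIn]
  | cons w ws ih => simp [Vals.ClosedIn, ih]

/-! Weakening of the set of free variables. -/

mutual
  theorem Val.ClosedIn.mono {B C : Set TVar} (h : B ⊆ C) :
      (w : Val) → w.ClosedIn B → w.ClosedIn C
    | .num _, _ => by simp [Val.ClosedIn]
    | .thunk P, hw => by
        simp only [Val.ClosedIn] at hw ⊢; exact Prog.ClosedIn.mono h P hw
    | .loc _, _ => by simp [Val.ClosedIn]
    | .arr vs, hw => by
        simp only [Val.ClosedIn] at hw ⊢; exact Vals.ClosedIn.mono h vs hw
    | .var y, hw => by simp only [Val.ClosedIn] at hw ⊢; exact h hw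
  theorem Vals.ClosedIn.mono {B C : Set TVar} (h : B ⊆ C) :
      (ws : List Val) → Vals.ClosedIn B ws → Vals.ClosedIn C ws
    | [], _ => by simp [Vals.ClosedIn]
    | w :: ws, hw => by
        simp only [Vals.ClosedIn] at hw ⊢
        exact ⟨Val.ClosedIn.mono h w hw.1, Vals.ClosedIn.mono h ws hw.2⟩
  theorem Instr.ClosedIn.mono {B C : Set TVar} (h : B ⊆ C) :
      (i : Instr) → i.ClosedIn B → i.ClosedIn C
    | .push w, hi => by
        simp only [Instr.ClosedIn] at hi ⊢; exact Val.ClosedIn.mono h w hi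
    | .if0 P₁ P₂, hi => by
        simp only [Instr.ClosedIn] at hi ⊢
        exact ⟨Prog.ClosedIn.mono h P₁ hi.1, Prog.ClosedIn.mono h P₂ hi.2⟩
    | .lam y P, hi => by
        simp only [Instr.ClosedIn] at hi ⊢
        exact Prog.ClosedIn.mono (Set.insert_subset_insert h) P hi
    | .add, _ | .less, _ | .call, _ | .idx, _ | .len, _ | .alloc, _ | .read, _ | .write, _
    | .fail _, _ => by simp [Instr.ClosedIn]
  theorem Prog.ClosedIn.mono {B C : Set TVar} (h : B ⊆ C) :
      (P : List Instr) → Prog.ClosedIn B P → Prog.ClosedIn C P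
    | [], _ => by simp [Prog.ClosedIn]
    | i :: P, hP => by
        simp only [Prog.ClosedIn] at hP ⊢
        exact ⟨Instr.ClosedIn.mono h i hP.1, Prog.ClosedIn.mono h P hP.2⟩
end

/-! Substituting for a variable that is not free. -/

mutual
  theorem Val.subst_of_closedIn {B : Set TVar} {x : TVar} (v : Val) (hx : x ∉ B) :
      (w : Val) → w.ClosedIn B → Val.subst x v w = w
    | .num _, _ => by simp [Val.subst]
    | .thunk P, hw => by
        simp only [Val.ClosedIn] at hw; simp [Val.subst, Prog.subst_of_closedIn v hx P hw]
    | .loc _, _ => by simp [Val.subst]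
    | .arr vs, hw => by
        simp only [Val.ClosedIn] at hw; simp [Val.subst, Vals.subst_of_closedIn v hx vs hw]
    | .var y, hw => by
        simp only [Val.ClosedIn] at hw
        have : y ≠ x := fun h => hx (h ▸ hw)
        simp [Val.subst, this]
  theorem Vals.subst_of_closedIn {B : Set TVar} {x : TVar} (v : Val) (hx : x ∉ B) :
      (ws : List Val) → Vals.ClosedIn B ws → Vals.subst x v ws = ws
    | [], _ => by simp [Vals.subst]
    | w :: ws, hw => by
        simp only [Vals.ClosedIn] at hw
        simp [Vals.subst, Val.subst_of_closedIn v hx w hw.1, Vals.subst_of_closedIn v hx ws hw.2]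
  theorem Instr.subst_of_closedIn {B : Set TVar} {x : TVar} (v : Val) (hx : x ∉ B) :
      (i : Instr) → i.ClosedIn B → Instr.subst x v i = i
    | .push w, hi => by
        simp only [Instr.ClosedIn] at hi; simp [Instr.subst, Val.subst_of_closedIn v hx w hi]
    | .if0 P₁ P₂, hi => by
        simp only [Instr.ClosedIn] at hi
        simp [Instr.subst, Prog.subst_of_closedIn v hx P₁ hi.1,
          Prog.subst_of_closedIn v hx P₂ hi.2]
    | .lam y P, hi => by
        simp only [Instr.ClosedIn] at hi
        by_cases hyx : y = x
        · simp [Instr.subst, hyx]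
        · have hx' : x ∉ insert y B := by
            simp only [Set.mem_insert_iff, not_or]; exact ⟨fun h => hyx h.symm, hx⟩
          simp [Instr.subst, Prog.subst_of_closedIn v hx' P hi]
    | .add, _ | .less, _ | .call, _ | .idx, _ | .len, _ | .alloc, _ | .read, _ | .write, _
    | .fail _, _ => by simp [Instr.subst]
  theorem Prog.subst_of_closedIn {B : Set TVar} {x : TVar} (v : Val) (hx : x ∉ B) :
      (P : List Instr) → Prog.ClosedIn B P → Prog.subst x v P = P
    | [], _ => by simp [Prog.subst]
    | i :: P, hP => by
        simp only [Prog.ClosedIn] at hP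
        simp [Prog.subst, Instr.subst_of_closedIn v hx i hP.1, Prog.subst_of_closedIn v hx P hP.2]
end

theorem Val.Closed.subst_eq {w : Val} (hw : w.Closed) (x : TVar) (v : Val) : Val.subst x v w = w :=
  Val.subst_of_closedIn v (Set.notMem_empty x) w hw

/-! A simultaneous substitution that does not touch the free variables. -/

mutual
  theorem Val.msubst_of_closedIn {B : Set TVar} {γ : Env} (h : ∀ y ∈ B, γ y = none) :
      (w : Val) → w.ClosedIn B → w.msubst γ = w
    | .num _, _ => by simp [Val.msubst]
    | .thunk P, hw => by
        simp only [Val.ClosedIn] at hw; simp [Val.msubst, Prog.msubst_of_closedIn h P hw]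
    | .loc _, _ => by simp [Val.msubst]
    | .arr vs, hw => by
        simp only [Val.ClosedIn] at hw; simp [Val.msubst, Vals.msubst_of_closedIn h vs hw]
    | .var y, hw => by
        simp only [Val.ClosedIn] at hw; simp [Val.msubst, h y hw]
  theorem Vals.msubst_of_closedIn {B : Set TVar} {γ : Env} (h : ∀ y ∈ B, γ y = none) :
      (ws : List Val) → Vals.ClosedIn B ws → Vals.msubst γ ws = ws
    | [], _ => by simp [Vals.msubst]
    | w :: ws, hw => by
        simp only [Vals.ClosedIn] at hw
        simp [Vals.msubst, Val.msubst_of_closedIn h w hw.1, Vals.msubst_of_closedIn h ws hw.2]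
  theorem Instr.msubst_of_closedIn {B : Set TVar} {γ : Env} (h : ∀ y ∈ B, γ y = none) :
      (i : Instr) → i.ClosedIn B → i.msubst γ = i
    | .push w, hi => by
        simp only [Instr.ClosedIn] at hi; simp [Instr.msubst, Val.msubst_of_closedIn h w hi]
    | .if0 P₁ P₂, hi => by
        simp only [Instr.ClosedIn] at hi
        simp [Instr.msubst, Prog.msubst_of_closedIn h P₁ hi.1, Prog.msubst_of_closedIn h P₂ hi.2]
    | .lam y P, hi => by
        simp only [Instr.ClosedIn] at hi
        have h' : ∀ z ∈ insert y B, Function.update γ y none z = none := by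
          intro z hz
          by_cases hzy : z = y
          · simp [hzy]
          · rw [Function.update_of_ne hzy]; exact h z (hz.resolve_left hzy)
        simp [Instr.msubst, Prog.msubst_of_closedIn h' P hi]
    | .add, _ | .less, _ | .call, _ | .idx, _ | .len, _ | .alloc, _ | .read, _ | .write, _
    | .fail _, _ => by simp [Instr.msubst]
  theorem Prog.msubst_of_closedIn {B : Set TVar} {γ : Env} (h : ∀ y ∈ B, γ y = none) :
      (P : List Instr) → Prog.ClosedIn B P → Prog.msubst γ P = P
    | [], _ => by simp [Prog.msubst]
    | i :: P, hP => by
        simp only [Prog.ClosedIn] at hP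
        simp [Prog.msubst, Instr.msubst_of_closedIn h i hP.1, Prog.msubst_of_closedIn h P hP.2]
end

theorem Prog.msubst_of_closed (γ : Env) {P : Prog} (h : Prog.ClosedIn ∅ P) :
    Prog.msubst γ P = P :=
  Prog.msubst_of_closedIn (by simp) P h

/-! Free variables of the result of a simultaneous substitution. -/

mutual
  theorem Val.closedIn_msubst {B C : Set TVar} {γ : Env} (hγ : γ.Closed)
      (h : ∀ y ∈ B, γ y = none → y ∈ C) : (w : Val) → w.ClosedIn B → (w.msubst γ).ClosedIn C
    | .num _, _ => by simp [Val.msubst, Val.ClosedIn]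
    | .thunk P, hw => by
        simp only [Val.ClosedIn, Val.msubst] at hw ⊢; exact Prog.closedIn_msubst hγ h P hw
    | .loc _, _ => by simp [Val.msubst, Val.ClosedIn]
    | .arr vs, hw => by
        simp only [Val.ClosedIn, Val.msubst] at hw ⊢; exact Vals.closedIn_msubst hγ h vs hw
    | .var y, hw => by
        simp only [Val.ClosedIn] at hw
        rcases hy : γ y with _ | v
        · simpa [Val.msubst, hy, Val.ClosedIn] using h y hw hy
        · simpa [Val.msubst, hy] using Val.ClosedIn.mono (Set.empty_subset C) v (hγ y v hy)
  theorem Vals.closedIn_msubst {B C : Set TVar} {γ : Env} (hγ : γ.Closed)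
      (h : ∀ y ∈ B, γ y = none → y ∈ C) :
      (ws : List Val) → Vals.ClosedIn B ws → Vals.ClosedIn C (Vals.msubst γ ws)
    | [], _ => by simp [Vals.msubst, Vals.ClosedIn]
    | w :: ws, hw => by
        simp only [Vals.ClosedIn, Vals.msubst] at hw ⊢
        exact ⟨Val.closedIn_msubst hγ h w hw.1, Vals.closedIn_msubst hγ h ws hw.2⟩
  theorem Instr.closedIn_msubst {B C : Set TVar} {γ : Env} (hγ : γ.Closed)
      (h : ∀ y ∈ B, γ y = none → y ∈ C) :
      (i : Instr) → i.ClosedIn B → (i.msubst γ).ClosedIn C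
    | .push w, hi => by
        simp only [Instr.ClosedIn, Instr.msubst] at hi ⊢; exact Val.closedIn_msubst hγ h w hi
    | .if0 P₁ P₂, hi => by
        simp only [Instr.ClosedIn, Instr.msubst] at hi ⊢
        exact ⟨Prog.closedIn_msubst hγ h P₁ hi.1, Prog.closedIn_msubst hγ h P₂ hi.2⟩
    | .lam y P, hi => by
        simp only [Instr.ClosedIn, Instr.msubst] at hi ⊢
        refine Prog.closedIn_msubst (hγ.update_none y) ?_ P hi
        intro z hz hn
        by_cases hzy : z = y
        · simp [hzy]
        · rw [Function.update_of_ne hzy] at hn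
          exact Or.inr (h z (hz.resolve_left hzy) hn)
    | .add, _ | .less, _ | .call, _ | .idx, _ | .len, _ | .alloc, _ | .read, _ | .write, _
    | .fail _, _ => by simp [Instr.msubst, Instr.ClosedIn]
  theorem Prog.closedIn_msubst {B C : Set TVar} {γ : Env} (hγ : γ.Closed)
      (h : ∀ y ∈ B, γ y = none → y ∈ C) :
      (P : List Instr) → Prog.ClosedIn B P → Prog.ClosedIn C (Prog.msubst γ P)
    | [], _ => by simp [Prog.msubst, Prog.ClosedIn]
    | i :: P, hP => by
        simp only [Prog.ClosedIn, Prog.msubst] at hP ⊢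
        exact ⟨Instr.closedIn_msubst hγ h i hP.1, Prog.closedIn_msubst hγ h P hP.2⟩
end

/-! A single substitution after a simultaneous one. -/

mutual
  theorem Val.subst_msubst {γ : Env} (hγ : γ.Closed) {x : TVar} (hx : γ x = none) (v : Val) :
      (w : Val) → Val.subst x v (w.msubst γ) = w.msubst (Function.update γ x (some v))
    | .num _ => by simp [Val.msubst, Val.subst]
    | .thunk P => by simp [Val.msubst, Val.subst, Prog.subst_msubst hγ hx v P]
    | .loc _ => by simp [Val.msubst, Val.subst]
    | .arr vs => by simp [Val.msubst, Val.subst, Vals.subst_msubst hγ hx v vs]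
    | .var y => by
        by_cases hyx : y = x
        · subst hyx; simp [Val.msubst, Val.subst, hx]
        · rcases hy : γ y with _ | u
          · simp [Val.msubst, Val.subst, hy, hyx]
          -- Values inserted earlier are closed, so the later substitution does not reach into them.
          · simp [Val.msubst, hy, hyx, (hγ y u hy).subst_eq]
  theorem Vals.subst_msubst {γ : Env} (hγ : γ.Closed) {x : TVar} (hx : γ x = none) (v : Val) :
      (ws : List Val) →
        Vals.subst x v (Vals.msubst γ ws) = Vals.msubst (Function.update γ x (some v)) ws
    | [] => by simp [Vals.msubst, Vals.subst]
    | w :: ws => by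
        simp [Vals.msubst, Vals.subst, Val.subst_msubst hγ hx v w, Vals.subst_msubst hγ hx v ws]
  theorem Instr.subst_msubst {γ : Env} (hγ : γ.Closed) {x : TVar} (hx : γ x = none) (v : Val) :
      (i : Instr) → Instr.subst x v (i.msubst γ) = i.msubst (Function.update γ x (some v))
    | .push w => by simp [Instr.msubst, Instr.subst, Val.subst_msubst hγ hx v w]
    | .if0 P₁ P₂ => by
        simp [Instr.msubst, Instr.subst, Prog.subst_msubst hγ hx v P₁,
          Prog.subst_msubst hγ hx v P₂]
    | .lam y P => by
        by_cases hyx : y = x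
        · subst hyx; simp [Instr.msubst, Instr.subst]
        · have hx' : Function.update γ y none x = none := by
            rw [Function.update_of_ne (Ne.symm hyx)]; exact hx
          simp [Instr.msubst, Instr.subst, hyx, Prog.subst_msubst (hγ.update_none y) hx' v P,
            Function.update_comm hyx]
    | .add | .less | .call | .idx | .len | .alloc | .read | .write
    | .fail _ => by simp [Instr.msubst, Instr.subst]
  theorem Prog.subst_msubst {γ : Env} (hγ : γ.Closed) {x : TVar} (hx : γ x = none) (v : Val) :
      (P : List Instr) →
        Prog.subst x v (Prog.msubst γ P) = Prog.msubst (Function.update γ x (some v)) P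
    | [] => by simp [Prog.msubst, Prog.subst]
    | i :: P => by
        simp [Prog.msubst, Prog.subst, Instr.subst_msubst hγ hx v i, Prog.subst_msubst hγ hx v P]
end

/-- This is what happens when the machine executes a `lam` in substituted code: the body ends up
under the enlarged substitution, to which the semantic typing of the body applies. -/
theorem Prog.subst_msubst_update {γ : Env} (hγ : γ.Closed) (x : TVar) (v : Val) (P : Prog) :
    Prog.subst x v (Prog.msubst (Function.update γ x none) P) =
      Prog.msubst (Function.update γ x (some v)) P := by
  rw [Prog.subst_msubst (hγ.update_none x) (by simp), Function.update_idem]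

/-! ## Safety up to a number of steps -/

/-- The admissible final configurations. -/
def Config.Final (c : Config) : Prop :=
  c.prog = [] ∧
    ((∃ err : Err, (err = .convErr ∨ err = .idxErr) ∧ c.stack = .fail err) ∨
      (∃ v : Val, v.Closed ∧ c.stack = .ok [v]))

/-- Every configuration reached in fewer than `k` steps steps further or is final. -/
def Safe : ℕ → Config → Prop
  | 0, _ => True
  | k + 1, c => (c.Final ∨ ∃ c', Step c c') ∧ ∀ c', Step c c' → Safe k c'

theorem Safe.pred {k : ℕ} {c : Config} (h : Safe (k + 1) c) : Safe k c := by
  induction k generalizing c with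
  | zero => trivial
  | succ k ih => exact ⟨h.1, fun c' hc => ih (h.2 c' hc)⟩

/-- Index `k` for a reduct comes from index `k + 1` for its predecessor, so safety at all indices
survives reduction. -/
theorem Safe.of_steps {c c' : Config} (h : ∀ k, Safe k c) (hs : Steps c c') :
    c'.Final ∨ ∃ c'', Step c' c'' := by
  have : ∀ k, Safe k c' := by
    induction hs with
    | refl => exact h
    | tail _ hbc ih => exact fun k => (ih (k + 1)).2 _ hbc
  exact (this 1).1

/-- The step to `d` only witnesses progress; the second hypothesis covers all successors, because
`alloc` is nondeterministic. -/
theorem Safe.succ_of_step {k : ℕ} {c d : Config} (hs : Step c d)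
    (h : ∀ c', Step c c' → Safe k c') : Safe (k + 1) c :=
  ⟨Or.inr ⟨d, hs⟩, h⟩

/-- Forgets the step just gained, so that instruction rules need no counting. -/
theorem Safe.of_step {k : ℕ} {c d : Config} (hs : Step c d)
    (h : ∀ c', Step c c' → Safe k c') : Safe k c :=
  (Safe.succ_of_step hs h).pred

-- Safety rules for instructions and macros

section Instructions

variable {k : ℕ} {H : Heap} {S : List Val} {P : Prog}

theorem Safe.push {v : Val} (hv : v.Closed) (h : Safe k ⟨H, .ok (v :: S), P⟩) :
    Safe k ⟨H, .ok S, .push v :: P⟩ := by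
  refine Safe.of_step (.push hv) fun c hc => ?_
  cases hc with
  | push => exact h
  -- The stack has the required shape, so `StackOk` reduces to `True`.
  | typeFail hn => exact absurd trivial hn

theorem Safe.push_num {n : ℤ} (h : Safe k ⟨H, .ok (.num n :: S), P⟩) :
    Safe k ⟨H, .ok S, .push (.num n) :: P⟩ :=
  Safe.push (by simp [Val.Closed, Val.ClosedIn]) h

theorem Safe.add {n n' : ℤ} (h : Safe k ⟨H, .ok (.num (n + n') :: S), P⟩) :
    Safe k ⟨H, .ok (.num n :: .num n' :: S), .add :: P⟩ := by
  refine Safe.of_step .add fun c hc => ?_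
  cases hc with
  | add => exact h
  | typeFail hn => exact absurd trivial hn

theorem Safe.less {n n' : ℤ} (h : Safe k ⟨H, .ok (.num (if n < n' then 0 else 1) :: S), P⟩) :
    Safe k ⟨H, .ok (.num n :: .num n' :: S), .less :: P⟩ := by
  refine Safe.of_step .less fun c hc => ?_
  cases hc with
  | less => exact h
  | typeFail hn => exact absurd trivial hn

theorem Safe.if0 {n : ℤ} {P₁ P₂ : Prog} (h₁ : n = 0 → Safe k ⟨H, .ok S, P₁ ++ P⟩)
    (h₂ : n ≠ 0 → Safe k ⟨H, .ok S, P₂ ++ P⟩) :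
    Safe k ⟨H, .ok (.num n :: S), .if0 P₁ P₂ :: P⟩ := by
  refine Safe.of_step .if0 fun c hc => ?_
  cases hc with
  | if0 =>
    by_cases hn : n = 0
    · rw [if_pos hn]; exact h₁ hn
    · rw [if_neg hn]; exact h₂ hn
  | typeFail hn => exact absurd trivial hn

theorem Safe.lam {v : Val} {x : TVar} {P₁ : Prog}
    (h : Safe k ⟨H, .ok S, Prog.subst x v P₁ ++ P⟩) :
    Safe k ⟨H, .ok (v :: S), .lam x P₁ :: P⟩ := by
  refine Safe.of_step .lam fun c hc => ?_
  cases hc with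
  | lam => exact h
  | typeFail hn => exact absurd trivial hn

/-- A call uses up one step. -/
theorem Safe.call {P₁ : Prog} (h : Safe k ⟨H, .ok S, P₁ ++ P⟩) :
    Safe (k + 1) ⟨H, .ok (.thunk P₁ :: S), .call :: P⟩ := by
  refine Safe.succ_of_step .call fun c hc => ?_
  cases hc with
  | call => exact h
  | typeFail hn => exact absurd trivial hn

theorem Safe.fail {S : Stack} {err : Err} (herr : err = .convErr ∨ err = .idxErr) :
    Safe k ⟨H, S, .fail err :: P⟩ := by
  refine Safe.of_step .fail fun c hc => ?_
  cases hc with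
  | fail =>
    cases k with
    | zero => trivial
    | succ k =>
      refine ⟨Or.inl ⟨rfl, Or.inl ⟨err, herr, rfl⟩⟩, fun c' hc' => ?_⟩
      cases hc'
  | typeFail hn => exact absurd trivial hn

/-- No bound on `n` is needed: an index out of range ends in `idxErr`, which is an admissible
outcome. -/
theorem Safe.idx {n : ℤ} {vs : List Val}
    (h : ∀ v ∈ vs, 0 ≤ n → vs[n.toNat]? = some v → Safe k ⟨H, .ok (v :: S), P⟩) :
    Safe k ⟨H, .ok (.num n :: .arr vs :: S), .idx :: P⟩ := by
  have hs : ∃ d, Step ⟨H, .ok (.num n :: .arr vs :: S), .idx :: P⟩ d := by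
    by_cases hn : n < 0 ∨ (vs.length : ℤ) ≤ n
    · exact ⟨_, .idxFail hn⟩
    · have hlt : n.toNat < vs.length := by omega
      exact ⟨_, .idx (v := vs[n.toNat]) (by omega) (List.getElem?_eq_getElem hlt)⟩
  obtain ⟨d, hd⟩ := hs
  refine Safe.of_step hd fun c hc => ?_
  cases hc with
  | idx h0 hv => exact h _ (List.mem_of_getElem? hv) h0 hv
  | idxFail hn => exact Safe.fail (Or.inr rfl)
  | typeFail hn => exact absurd trivial hn

theorem Safe.idx_zero {v : Val} {vs : List Val} (h : Safe k ⟨H, .ok (v :: S), P⟩) :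
    Safe k ⟨H, .ok (.num 0 :: .arr (v :: vs) :: S), .idx :: P⟩ := by
  refine Safe.idx fun w _ _ hw => ?_
  simp at hw; exact hw ▸ h

theorem Safe.idx_one {u v : Val} {vs : List Val} (h : Safe k ⟨H, .ok (v :: S), P⟩) :
    Safe k ⟨H, .ok (.num 1 :: .arr (u :: v :: vs) :: S), .idx :: P⟩ := by
  refine Safe.idx fun w _ _ hw => ?_
  simp at hw; exact hw ▸ h

theorem Safe.len {vs : List Val} (h : Safe k ⟨H, .ok (.num (vs.length : ℤ) :: S), P⟩) :
    Safe k ⟨H, .ok (.arr vs :: S), .len :: P⟩ := by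
  refine Safe.of_step .len fun c hc => ?_
  cases hc with
  | len => exact h
  | typeFail hn => exact absurd trivial hn

theorem Safe.alloc {v : Val}
    (h : ∀ l, l ∉ H → Safe k ⟨H.insert l v, .ok (.loc l :: S), P⟩) :
    Safe k ⟨H, .ok (v :: S), .alloc :: P⟩ := by
  -- Heaps are finite, so a fresh location exists. It serves only for progress; the actual step may
  -- choose another one.
  obtain ⟨l, hl⟩ := Infinite.exists_notMem_finset H.keys
  refine Safe.of_step (.alloc (l := l) (by rwa [← Finmap.mem_keys])) fun c hc => ?_
  cases hc with
  | alloc hl => exact h _ hl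
  | typeFail hn => exact absurd trivial hn

theorem Safe.read {l : ℕ} {v : Val} (hl : H.lookup l = some v)
    (h : Safe k ⟨H, .ok (v :: S), P⟩) : Safe k ⟨H, .ok (.loc l :: S), .read :: P⟩ := by
  refine Safe.of_step (.read hl) fun c hc => ?_
  cases hc with
  | read hl' =>
    obtain rfl := Option.some.inj (hl.symm.trans hl')
    exact h
  | typeFail hn => exact absurd trivial hn

theorem Safe.write {l : ℕ} {v : Val} (hl : l ∈ H) (h : Safe k ⟨H.insert l v, .ok S, P⟩) :
    Safe k ⟨H, .ok (v :: .loc l :: S), .write :: P⟩ := by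
  refine Safe.of_step (.write hl) fun c hc => ?_
  cases hc with
  | write => exact h
  | typeFail hn => exact absurd trivial hn

/-- Closedness of `u` is used twice: the inner substitution must leave `u` unchanged, and only
closed values can be pushed. -/
theorem Safe.swap {u v : Val} (hu : u.Closed) (hv : v.Closed)
    (h : Safe k ⟨H, .ok (v :: u :: S), P⟩) : Safe k ⟨H, .ok (u :: v :: S), SWAP :: P⟩ := by
  refine Safe.lam ?_
  simp only [Prog.subst, Instr.subst, Val.subst, List.cons_append, List.nil_append,
    TVar.tmp.injEq, if_true, if_false, one_ne_zero]
  refine Safe.lam ?_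
  simp only [Prog.subst, Instr.subst, Val.subst, List.cons_append, List.nil_append,
    if_true, hu.subst_eq]
  exact Safe.push hu (Safe.push hv h)

theorem Safe.dup {v : Val} (hv : v.Closed)
    (h : Safe k ⟨H, .ok (v :: v :: S), P⟩) : Safe k ⟨H, .ok (v :: S), DUP :: P⟩ := by
  refine Safe.lam ?_
  simp only [Prog.subst, Instr.subst, Val.subst, List.cons_append, List.nil_append, if_true]
  exact Safe.push hv (Safe.push hv h)

theorem Val.closed_arr_iff (vs : List Val) : (Val.arr vs).Closed ↔ ∀ v ∈ vs, v.Closed := by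
  simp [Val.Closed, Val.ClosedIn, Vals.closedIn_iff]

theorem Val.closed_num (n : ℤ) : (Val.num n).Closed := by simp [Val.Closed, Val.ClosedIn]

theorem Safe.pair {u v : Val} (hu : u.Closed) (hv : v.Closed)
    (h : Safe k ⟨H, .ok (.arr [u, v] :: S), P⟩) : Safe k ⟨H, .ok (v :: u :: S), PAIR :: P⟩ := by
  refine Safe.lam ?_
  simp only [Prog.subst, Instr.subst, Val.subst, Vals.subst, List.cons_append, List.nil_append,
    TVar.tmp.injEq, if_true, if_false, zero_ne_one]
  refine Safe.lam ?_
  simp only [Prog.subst, Instr.subst, Val.subst, Vals.subst, List.cons_append, List.nil_append,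
    if_true, hv.subst_eq]
  exact Safe.push ((Val.closed_arr_iff _).2 (by simp [hu, hv])) h

/-- The instruction that adds the tag `n`. -/
theorem Safe.tag {n : ℤ} {v : Val} (hv : v.Closed)
    (h : Safe k ⟨H, .ok (.arr [.num n, v] :: S), P⟩) :
    Safe k ⟨H, .ok (v :: S), .lam (.tmp 0) [.push (.arr [.num n, .var (.tmp 0)])] :: P⟩ := by
  refine Safe.lam ?_
  simp only [Prog.subst, Instr.subst, Val.subst, Vals.subst, List.cons_append, List.nil_append,
    if_true]
  exact Safe.push ((Val.closed_arr_iff _).2 (by simp [hv, Val.closed_num])) h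

theorem Safe.untag {t v : Val} {vs : List Val} (hc : (Val.arr (t :: v :: vs)).Closed)
    (h : Safe k ⟨H, .ok (t :: v :: S), P⟩) :
    Safe k ⟨H, .ok (.arr (t :: v :: vs) :: S), UNTAG ++ P⟩ := by
  have hv : v.Closed := (Val.closed_arr_iff _).1 hc v (by simp)
  exact Safe.dup hc <| Safe.push_num <| Safe.idx_one <| Safe.swap hv hc <| Safe.push_num <|
    Safe.idx_zero h

theorem Safe.check2 {vs : List Val} (hc : (Val.arr vs).Closed)
    (h : 2 ≤ vs.length → Safe k ⟨H, .ok (.arr vs :: S), P⟩) :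
    Safe k ⟨H, .ok (.arr vs :: S), CHECK2 ++ P⟩ := by
  refine Safe.dup hc <| Safe.len <| Safe.push_num <|
    Safe.swap (Val.closed_num _) (Val.closed_num _) <| Safe.less <| Safe.if0 ?_ ?_
  -- `less` encodes truth as 0, so the zero branch is that of a too short array.
  · intro _; exact Safe.fail (Or.inl rfl)
  · intro hn
    refine h ?_
    by_contra hlt
    exact hn (if_pos (by omega))

/-- The binders are `tmp 0, …, tmp (m - 1)`, none of which is `tmp n`. -/
theorem subst_bindTmps {m n : ℕ} (hn : m ≤ n) (v : Val) (P : Prog) :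
    Prog.subst (.tmp n) v (bindTmps m P) = bindTmps m (Prog.subst (.tmp n) v P) := by
  induction m with
  | zero => rfl
  | succ m ih =>
    have : m ≠ n := by omega
    simp [bindTmps, Prog.subst, Instr.subst, this, ih (by omega)]

/-- The list `ws` holds the entries already filled in. The outermost binder takes the top of the
stack, which is the last entry; hence the induction removes entries from the right and moves them to
the front of `ws`. -/
theorem Safe.bindTmps {vs ws : List Val} (hvs : ∀ v ∈ vs, v.Closed) (hws : ∀ w ∈ ws, w.Closed)
    (h : Safe k ⟨H, .ok (.arr (vs ++ ws) :: S), P⟩) :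
    Safe k ⟨H, .ok (vs.reverse ++ S), bindTmps vs.length
      [.push (.arr ((List.range vs.length).map (fun i => Val.var (.tmp i)) ++ ws))] ++ P⟩ := by
  induction vs using List.reverseRecOn generalizing ws with
  | nil => exact Safe.push ((Val.closed_arr_iff _).2 hws) h
  | append_singleton vs v ih =>
    have hv : v.Closed := hvs v (by simp)
    have key := ih (ws := v :: ws) (fun u hu => hvs u (by simp [hu]))
      (by simpa [hv] using hws) (by simpa using h)
    simp only [List.length_append, List.length_singleton, List.reverse_append, List.reverse_singleton,
      List.cons_append, List.nil_append, RefLang.bindTmps]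
    refine Safe.lam ?_
    rw [subst_bindTmps le_rfl]
    convert key using 4
    simp only [Prog.subst, Instr.subst, Val.subst, Vals.subst_eq_map, List.range_succ,
      List.map_append, List.map_map, List.map_cons, List.map_nil, if_true, List.append_assoc,
      List.cons_append, List.nil_append]
    congr 4
    · refine List.map_congr_left fun i hi => ?_
      have : i ≠ vs.length := by have := List.mem_range.1 hi; omega
      simp [Val.subst, this]
    · exact congrArg _ ((List.map_congr_left fun w hw => (hws w hw).subst_eq _ _).trans
        (List.map_id _))

theorem Safe.mkArr {vs : List Val} (hvs : ∀ v ∈ vs, v.Closed)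
    (h : Safe k ⟨H, .ok (.arr vs :: S), P⟩) :
    Safe k ⟨H, .ok (vs.reverse ++ S), mkArr vs.length ++ P⟩ := by
  have := Safe.bindTmps (k := k) (H := H) (S := S) (P := P) (ws := []) hvs (by simp) (by simpa)
  simpa [RefLang.mkArr] using this

end Instructions

/-! ## The logical relation -/

/-- Types of target values; convertible primitive types are identified. -/
inductive Ty where
  | int
  | arr (T : Ty)
  | sum (T₁ T₂ : Ty)
  | prod (T₁ T₂ : Ty)
  | fn (T₁ T₂ : Ty)
  | ref (T : Ty)

/-- Sending `unit` to `int` forgets that its value is 0, which is harmless because no compiled code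
relies on it. Any integer is likewise a good boolean, as `if0` only tests for zero. -/
def HLType.toTy : HLType → Ty
  | .unit => .int
  | .bool => .int
  | .sum τ₁ τ₂ => .sum τ₁.toTy τ₂.toTy
  | .prod τ₁ τ₂ => .prod τ₁.toTy τ₂.toTy
  | .fn τ₁ τ₂ => .fn τ₁.toTy τ₂.toTy
  | .ref τ => .ref τ.toTy

def LLType.toTy : LLType → Ty
  | .int => .int
  | .arr τ => .arr τ.toTy
  | .fn τ₁ τ₂ => .fn τ₁.toTy τ₂.toTy
  | .ref τ => .ref τ.toTy

/-- Heap typings. -/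
abbrev World := ℕ → Option Ty

/-- `Ψ'` extends `Ψ`. -/
def World.Le (Ψ Ψ' : World) : Prop := ∀ l T, Ψ l = some T → Ψ' l = some T

theorem World.Le.refl (Ψ : World) : Ψ.Le Ψ := fun _ _ h => h

theorem World.Le.trans {Ψ₁ Ψ₂ Ψ₃ : World} (h : Ψ₁.Le Ψ₂) (h' : Ψ₂.Le Ψ₃) : Ψ₁.Le Ψ₃ :=
  fun l T hl => h' l T (h l T hl)

/-- The step-indexed value relation. A function value is described through the safety of all
machine configurations in which it is called. -/
def ValRel : ℕ → Ty → World → Val → Prop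
  | _, .int, _, v => ∃ n, v = .num n
  | k, .arr T, Ψ, v => ∃ vs, v = .arr vs ∧ ∀ w ∈ vs, ValRel k T Ψ w
  | k, .sum T₁ T₂, Ψ, v => ∃ w, (v = .arr [.num 0, w] ∧ ValRel k T₁ Ψ w) ∨
      (v = .arr [.num 1, w] ∧ ValRel k T₂ Ψ w)
  | k, .prod T₁ T₂, Ψ, v => ∃ w₁ w₂, v = .arr [w₁, w₂] ∧ ValRel k T₁ Ψ w₁ ∧ ValRel k T₂ Ψ w₂
  | _, .ref T, Ψ, v => ∃ l, v = .loc l ∧ Ψ l = some T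
  | k, .fn T₁ T₂, Ψ, v => ∃ P, v = .thunk P ∧ v.Closed ∧
      -- The heap clause below involves values of arbitrary types, so only the strict drop of the
      -- index justifies the recursion. The two long hypotheses are `HeapRel` and `ContRel` written
      -- out, since those are defined from `ValRel`.
      ∀ j, j < k → ∀ Ψ', Ψ.Le Ψ' → ∀ w H S K, ValRel j T₁ Ψ' w →
        (∀ l T, Ψ' l = some T → ∃ u, H.lookup l = some u ∧ ValRel j T Ψ' u) →
        (∀ i, i ≤ j → ∀ Ψ'', Ψ'.Le Ψ'' → ∀ H' u,
          (∀ l T, Ψ'' l = some T → ∃ u', H'.lookup l = some u' ∧ ValRel i T Ψ'' u') →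
          ValRel i T₂ Ψ'' u → Safe i ⟨H', .ok (u :: S), K⟩) →
        Safe j ⟨H, .ok (w :: S), P ++ K⟩
termination_by k T => (k, T)
decreasing_by
  all_goals first
    | exact Prod.Lex.left _ _ (by omega)
    | exact Prod.Lex.right _ (by simp +arith)

/-- The heap contains, at every location of the world, a value of the type prescribed there. -/
def HeapRel (k : ℕ) (Ψ : World) (H : Heap) : Prop :=
  ∀ l T, Ψ l = some T → ∃ u, H.lookup l = some u ∧ ValRel k T Ψ u

/-- The program `K` is safe, with the value of a term of type `T` put on the stack `S`. -/
def ContRel (k : ℕ) (T : Ty) (Ψ : World) (S : List Val) (K : Prog) : Prop :=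
  ∀ i, i ≤ k → ∀ Ψ', Ψ.Le Ψ' → ∀ H v, HeapRel i Ψ' H → ValRel i T Ψ' v →
    Safe i ⟨H, .ok (v :: S), K⟩

-- Unfolding, closedness and monotonicity of the relations

theorem valRel_int {k Ψ v} : ValRel k .int Ψ v ↔ ∃ n, v = .num n := by rw [ValRel]

theorem valRel_arr {k T Ψ v} :
    ValRel k (.arr T) Ψ v ↔ ∃ vs, v = .arr vs ∧ ∀ w ∈ vs, ValRel k T Ψ w := by rw [ValRel]

theorem valRel_sum {k T₁ T₂ Ψ v} :
    ValRel k (.sum T₁ T₂) Ψ v ↔ ∃ w, (v = .arr [.num 0, w] ∧ ValRel k T₁ Ψ w) ∨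
      (v = .arr [.num 1, w] ∧ ValRel k T₂ Ψ w) := by rw [ValRel]

theorem valRel_prod {k T₁ T₂ Ψ v} :
    ValRel k (.prod T₁ T₂) Ψ v ↔
      ∃ w₁ w₂, v = .arr [w₁, w₂] ∧ ValRel k T₁ Ψ w₁ ∧ ValRel k T₂ Ψ w₂ := by rw [ValRel]

theorem valRel_ref {k T Ψ v} :
    ValRel k (.ref T) Ψ v ↔ ∃ l, v = .loc l ∧ Ψ l = some T := by rw [ValRel]

theorem valRel_fn {k T₁ T₂ Ψ v} :
    ValRel k (.fn T₁ T₂) Ψ v ↔ ∃ P, v = .thunk P ∧ v.Closed ∧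
      ∀ j, j < k → ∀ Ψ', Ψ.Le Ψ' → ∀ w H S K, ValRel j T₁ Ψ' w → HeapRel j Ψ' H →
        ContRel j T₂ Ψ' S K → Safe j ⟨H, .ok (w :: S), P ++ K⟩ := by
  rw [ValRel]; rfl

theorem ValRel.closed {k T Ψ v} (h : ValRel k T Ψ v) : v.Closed := by
  induction T generalizing v with
  | int => obtain ⟨n, rfl⟩ := valRel_int.1 h; exact Val.closed_num n
  | arr T ih =>
    obtain ⟨vs, rfl, hvs⟩ := valRel_arr.1 h
    exact (Val.closed_arr_iff _).2 fun w hw => ih (hvs w hw)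
  | sum T₁ T₂ ih₁ ih₂ =>
    obtain ⟨w, ⟨rfl, hw⟩ | ⟨rfl, hw⟩⟩ := valRel_sum.1 h
    · exact (Val.closed_arr_iff _).2 (by simp [Val.closed_num, ih₁ hw])
    · exact (Val.closed_arr_iff _).2 (by simp [Val.closed_num, ih₂ hw])
  | prod T₁ T₂ ih₁ ih₂ =>
    obtain ⟨w₁, w₂, rfl, h₁, h₂⟩ := valRel_prod.1 h
    exact (Val.closed_arr_iff _).2 (by simp [ih₁ h₁, ih₂ h₂])
  | fn T₁ T₂ => obtain ⟨P, rfl, hc, _⟩ := valRel_fn.1 h; exact hc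
  | ref T => obtain ⟨l, rfl, _⟩ := valRel_ref.1 h; simp [Val.Closed, Val.ClosedIn]

/-- The function clause already quantifies over smaller indices and larger worlds, so contravariance
of the domain does no harm. -/
theorem ValRel.mono {k j T Ψ Ψ' v} (hj : j ≤ k) (hΨ : Ψ.Le Ψ') (h : ValRel k T Ψ v) :
    ValRel j T Ψ' v := by
  induction T generalizing v with
  | int => exact valRel_int.2 (valRel_int.1 h)
  | arr T ih =>
    obtain ⟨vs, rfl, hvs⟩ := valRel_arr.1 h
    exact valRel_arr.2 ⟨vs, rfl, fun w hw => ih (hvs w hw)⟩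
  | sum T₁ T₂ ih₁ ih₂ =>
    obtain ⟨w, ⟨rfl, hw⟩ | ⟨rfl, hw⟩⟩ := valRel_sum.1 h
    · exact valRel_sum.2 ⟨w, Or.inl ⟨rfl, ih₁ hw⟩⟩
    · exact valRel_sum.2 ⟨w, Or.inr ⟨rfl, ih₂ hw⟩⟩
  | prod T₁ T₂ ih₁ ih₂ =>
    obtain ⟨w₁, w₂, rfl, h₁, h₂⟩ := valRel_prod.1 h
    exact valRel_prod.2 ⟨w₁, w₂, rfl, ih₁ h₁, ih₂ h₂⟩
  | fn T₁ T₂ =>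
    obtain ⟨P, rfl, hc, hP⟩ := valRel_fn.1 h
    exact valRel_fn.2 ⟨P, rfl, hc, fun i hi Ψ'' hΨ'' => hP i (by omega) Ψ'' (hΨ.trans hΨ'')⟩
  | ref T =>
    obtain ⟨l, rfl, hl⟩ := valRel_ref.1 h
    exact valRel_ref.2 ⟨l, rfl, hΨ l T hl⟩

/-- The world stays fixed: a larger one would make demands on more locations. -/
theorem HeapRel.mono {k j Ψ H} (hj : j ≤ k) (h : HeapRel k Ψ H) : HeapRel j Ψ H := by
  intro l T hl
  obtain ⟨u, hu, hv⟩ := h l T hl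
  exact ⟨u, hu, hv.mono hj (.refl Ψ)⟩

theorem ContRel.mono {k j T Ψ Ψ' S K} (hj : j ≤ k) (hΨ : Ψ.Le Ψ') (h : ContRel k T Ψ S K) :
    ContRel j T Ψ' S K :=
  fun i hi Ψ'' hΨ'' => h i (hi.trans hj) Ψ'' (hΨ.trans hΨ'')

theorem HeapRel.insert {k Ψ H l T v} (h : HeapRel k Ψ H) (hl : Ψ l = some T)
    (hv : ValRel k T Ψ v) : HeapRel k Ψ (H.insert l v) := by
  intro l' T' hl'
  by_cases hll : l' = l
  · subst hll
    obtain rfl := Option.some.inj (hl.symm.trans hl')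
    exact ⟨v, Finmap.lookup_insert H, hv⟩
  · rw [Finmap.lookup_insert_of_ne H hll]; exact h l' T' hl'

theorem HeapRel.alloc {k Ψ H l T v} (h : HeapRel k Ψ H) (hl : l ∉ H) (hv : ValRel k T Ψ v) :
    Ψ.Le (Function.update Ψ l (some T)) ∧
      HeapRel k (Function.update Ψ l (some T)) (H.insert l v) := by
  have hle : Ψ.Le (Function.update Ψ l (some T)) := by
    intro l' T' hl'
    -- Every location of the world lies in the heap, so a location fresh for the heap is fresh for
    -- the world.
    have hne : l' ≠ l := by
      rintro rfl
      obtain ⟨u, hu, _⟩ := h l' T' hl'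
      exact hl (Finmap.mem_of_lookup_eq_some hu)
    rw [Function.update_of_ne hne]; exact hl'
  refine ⟨hle, fun l' T' hl' => ?_⟩
  by_cases hll : l' = l
  · subst hll
    simp only [Function.update_self, Option.some.injEq] at hl'
    subst hl'
    exact ⟨v, Finmap.lookup_insert H, hv.mono le_rfl hle⟩
  · rw [Function.update_of_ne hll] at hl'
    obtain ⟨u, hu, hu'⟩ := h l' T' hl'
    exact ⟨u, by rw [Finmap.lookup_insert_of_ne H hll]; exact hu, hu'.mono le_rfl hle⟩

/-- At index `k + 1` the call consumes one step, which pays for using the function clause at `k`. -/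
theorem ValRel.call {k T₁ T₂ Ψ f w H S K} (hf : ValRel k (.fn T₁ T₂) Ψ f)
    (hw : ValRel k T₁ Ψ w) (hH : HeapRel k Ψ H) (hK : ContRel k T₂ Ψ S K) :
    Safe k ⟨H, .ok (f :: w :: S), .call :: K⟩ := by
  cases k with
  | zero => trivial
  | succ k =>
    obtain ⟨P, rfl, _, hP⟩ := valRel_fn.1 hf
    exact Safe.call (hP k (by omega) Ψ (.refl Ψ) w H S K (hw.mono (by omega) (.refl Ψ))
      (hH.mono (by omega)) (hK.mono (by omega) (.refl Ψ)))

/-! ## Soundness of the glue code -/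

/-- Glue code neither calls nor touches the heap, so index, world and heap stay fixed. The induction
varies `S` and `K` because the glue of a component runs above saved values and before the rest of
the code. -/
theorem Conv.safe_toLL {τA τB} (c : Conv τA τB) {k Ψ H S K v} (hv : ValRel k τA.toTy Ψ v)
    (hK : ∀ v', ValRel k τB.toTy Ψ v' → Safe k ⟨H, .ok (v' :: S), K⟩) :
    Safe k ⟨H, .ok (v :: S), c.toLL ++ K⟩ := by
  induction c generalizing v S K with
  | bool => exact hK v hv
  | refBool => exact hK v hv
  | sum c₁ c₂ ih₁ ih₂ =>
    -- Both branches end by pairing the tag with the converted payload; at type `[int]` any integer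
    -- tag is acceptable.
    have fin : ∀ (n : ℤ) w, ValRel k .int Ψ w →
        Safe k ⟨H, .ok (w :: .num n :: S), PAIR :: K⟩ := fun n w hw =>
      Safe.pair (Val.closed_num n) hw.closed <| hK _ <| valRel_arr.2 ⟨_, rfl, by
        simp only [List.mem_cons, List.not_mem_nil, or_false, forall_eq_or_imp, forall_eq]
        exact ⟨valRel_int.2 ⟨n, rfl⟩, hw⟩⟩
    have hc := hv.closed
    simp only [Conv.toLL, List.append_assoc, List.cons_append, List.nil_append]
    obtain ⟨w, ⟨rfl, hw⟩ | ⟨rfl, hw⟩⟩ := valRel_sum.1 hv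
    · refine Safe.untag hc <| Safe.dup (Val.closed_num _) <| Safe.if0 (fun _ => ?_)
        (fun h => absurd rfl h)
      exact Safe.swap (Val.closed_num _) hw.closed <| ih₁ hw fun v' hv' => fin 0 v' hv'
    · refine Safe.untag hc <| Safe.dup (Val.closed_num _) <| Safe.if0
        (fun h => absurd h one_ne_zero) (fun _ => ?_)
      exact Safe.swap (Val.closed_num _) hw.closed <| ih₂ hw fun v' hv' => fin 1 v' hv'
  | prod c₁ c₂ ih₁ ih₂ =>
    have hc := hv.closed
    obtain ⟨w₁, w₂, rfl, h₁, h₂⟩ := valRel_prod.1 hv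
    simp only [Conv.toLL, List.append_assoc, List.cons_append, List.nil_append]
    refine Safe.dup hc <| Safe.push_num <| Safe.idx_zero <| ih₁ h₁ fun u₁ hu₁ => ?_
    refine Safe.swap hu₁.closed hc <| Safe.push_num <| Safe.idx_one <| ih₂ h₂ fun u₂ hu₂ => ?_
    refine Safe.pair hu₁.closed hu₂.closed <| hK _ <| valRel_arr.2 ⟨_, rfl, ?_⟩
    simp only [List.mem_cons, List.not_mem_nil, or_false, forall_eq_or_imp, forall_eq]
    exact ⟨hu₁, hu₂⟩

/-- An array type guarantees neither two entries nor a valid tag; the run-time checks supply both or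
end in `convErr`. Entries after the second are dropped, since a new array is built. -/
theorem Conv.safe_toHL {τA τB} (c : Conv τA τB) {k Ψ H S K v} (hv : ValRel k τB.toTy Ψ v)
    (hK : ∀ v', ValRel k τA.toTy Ψ v' → Safe k ⟨H, .ok (v' :: S), K⟩) :
    Safe k ⟨H, .ok (v :: S), c.toHL ++ K⟩ := by
  induction c generalizing v S K with
  | bool => exact hK v hv
  | refBool => exact hK v hv
  | sum c₁ c₂ ih₁ ih₂ =>
    have hc := hv.closed
    obtain ⟨vs, rfl, hvs⟩ := valRel_arr.1 hv
    simp only [Conv.toHL, List.append_assoc, List.cons_append, List.nil_append]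
    refine Safe.check2 hc fun hlen => ?_
    match vs, hlen with
    | t :: w :: vs, _ =>
      obtain ⟨n, rfl⟩ := valRel_int.1 (hvs t (by simp))
      have hw : ValRel k .int Ψ w := hvs w (by simp)
      refine Safe.untag hc <| Safe.dup (Val.closed_num _) <| Safe.if0 (fun hn => ?_) (fun _ => ?_)
      · subst hn
        refine Safe.swap (Val.closed_num _) hw.closed <| ih₁ hw fun u hu => ?_
        exact Safe.pair (Val.closed_num _) hu.closed <| hK _ <|
          valRel_sum.2 ⟨u, Or.inl ⟨rfl, hu⟩⟩
      · refine Safe.dup (Val.closed_num _) <| Safe.push_num <| Safe.add <|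
          Safe.if0 (fun hn => ?_) (fun _ => Safe.fail (Or.inl rfl))
        -- The inner test is on `-1 + n`.
        obtain rfl : n = 1 := by omega
        refine Safe.swap (Val.closed_num _) hw.closed <| ih₂ hw fun u hu => ?_
        exact Safe.pair (Val.closed_num _) hu.closed <| hK _ <|
          valRel_sum.2 ⟨u, Or.inr ⟨rfl, hu⟩⟩
  | prod c₁ c₂ ih₁ ih₂ =>
    have hc := hv.closed
    obtain ⟨vs, rfl, hvs⟩ := valRel_arr.1 hv
    simp only [Conv.toHL, List.append_assoc, List.cons_append, List.nil_append]
    refine Safe.check2 hc fun hlen => ?_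
    match vs, hlen with
    | w₁ :: w₂ :: vs, _ =>
      refine Safe.dup hc <| Safe.push_num <| Safe.idx_zero <|
        ih₁ (hvs w₁ (by simp)) fun u₁ hu₁ => ?_
      refine Safe.swap hu₁.closed hc <| Safe.push_num <| Safe.idx_one <|
        ih₂ (hvs w₂ (by simp)) fun u₂ hu₂ => ?_
      exact Safe.pair hu₁.closed hu₂.closed <| hK _ <| valRel_prod.2 ⟨u₁, u₂, rfl, hu₁, hu₂⟩

/-! ## Free variables of compiled programs -/

theorem closedIn_SWAP (B : Set TVar) : SWAP.ClosedIn B := by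
  simp [SWAP, Instr.ClosedIn, Prog.ClosedIn, Val.ClosedIn]

theorem closedIn_DUP (B : Set TVar) : DUP.ClosedIn B := by
  simp [DUP, Instr.ClosedIn, Prog.ClosedIn, Val.ClosedIn]

theorem closedIn_PAIR (B : Set TVar) : PAIR.ClosedIn B := by
  simp [PAIR, Instr.ClosedIn, Prog.ClosedIn, Val.ClosedIn, Vals.ClosedIn]

theorem closedIn_UNTAG (B : Set TVar) : Prog.ClosedIn B UNTAG := by
  simp [UNTAG, closedIn_SWAP, closedIn_DUP, Instr.ClosedIn, Prog.ClosedIn, Val.ClosedIn]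

theorem closedIn_CHECK2 (B : Set TVar) : Prog.ClosedIn B CHECK2 := by
  simp [CHECK2, closedIn_SWAP, closedIn_DUP, Instr.ClosedIn, Prog.ClosedIn, Val.ClosedIn]

theorem closedIn_tag (B : Set TVar) (n : ℤ) :
    Prog.ClosedIn B [.lam (.tmp 0) [.push (.arr [.num n, .var (.tmp 0)])]] := by
  simp [Instr.ClosedIn, Prog.ClosedIn, Val.ClosedIn, Vals.ClosedIn]

theorem Conv.closedIn_toLL {τA τB} (c : Conv τA τB) (B : Set TVar) : Prog.ClosedIn B c.toLL := by
  induction c <;>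
    simp_all [Conv.toLL, Prog.closedIn_append, closedIn_UNTAG, closedIn_SWAP, closedIn_DUP,
      closedIn_PAIR, Instr.ClosedIn, Prog.ClosedIn, Val.ClosedIn]

theorem Conv.closedIn_toHL {τA τB} (c : Conv τA τB) (B : Set TVar) : Prog.ClosedIn B c.toHL := by
  induction c <;>
    simp_all [Conv.toHL, Prog.closedIn_append, closedIn_UNTAG, closedIn_CHECK2, closedIn_SWAP,
      closedIn_DUP, closedIn_PAIR, Instr.ClosedIn, Prog.ClosedIn, Val.ClosedIn]

/-- The hypothesis ranges over all larger sets `C` because each binder enlarges the set in the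
induction. -/
theorem closedIn_bindTmps {B : Set TVar} {n : ℕ} {P : Prog}
    (h : ∀ C, B ⊆ C → (∀ i < n, TVar.tmp i ∈ C) → Prog.ClosedIn C P) :
    Prog.ClosedIn B (bindTmps n P) := by
  induction n generalizing B with
  | zero => exact h B subset_rfl (by simp)
  | succ n ih =>
    simp only [bindTmps, Prog.ClosedIn, Instr.ClosedIn, and_true]
    refine ih fun C hC hi => h C ((Set.subset_insert _ _).trans hC) fun i hlt => ?_
    rcases Nat.lt_succ_iff_lt_or_eq.1 hlt with hlt | rfl
    · exact hi i hlt
    · exact hC (Set.mem_insert _ _)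

theorem closedIn_mkArr (B : Set TVar) (n : ℕ) : Prog.ClosedIn B (mkArr n) := by
  refine closedIn_bindTmps fun C _ hi => ?_
  simp only [Prog.ClosedIn, Instr.ClosedIn, Val.ClosedIn, Vals.closedIn_iff, and_true]
  intro w hw
  obtain ⟨i, hlt, rfl⟩ := List.mem_map.1 hw
  exact hi i (List.mem_range.1 hlt)

/-- The variables bound by a pair of source environments. -/
def ctxDom (Δ : LLCtx) (Γ : HLCtx) : Set TVar :=
  {y | (∃ x τ, y = .hl x ∧ Γ x = some τ) ∨ ∃ x τ, y = .ll x ∧ Δ x = some τ}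

theorem ctxDom_extend_hl (Δ : LLCtx) (Γ : HLCtx) (x : ℕ) (τ : HLType) :
    ctxDom Δ (extend Γ x τ) ⊆ insert (.hl x) (ctxDom Δ Γ) := by
  rintro y (⟨z, σ, rfl, hz⟩ | h)
  · by_cases hzx : z = x
    · simp [hzx]
    · rw [extend, Function.update_of_ne hzx] at hz
      exact Or.inr (Or.inl ⟨z, σ, rfl, hz⟩)
  · exact Or.inr (Or.inr h)

theorem ctxDom_extend_ll (Δ : LLCtx) (Γ : HLCtx) (x : ℕ) (τ : LLType) :
    ctxDom (extend Δ x τ) Γ ⊆ insert (.ll x) (ctxDom Δ Γ) := by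
  rintro y (h | ⟨z, σ, rfl, hz⟩)
  · exact Or.inr (Or.inl h)
  · by_cases hzx : z = x
    · simp [hzx]
    · rw [extend, Function.update_of_ne hzx] at hz
      exact Or.inr (Or.inr ⟨z, σ, rfl, hz⟩)

mutual
  -- Needed for thunks, whose closedness is part of `ValRel`.
  theorem HLTyping.closedIn_compile : {Δ : LLCtx} → {Γ : HLCtx} → {e : HLExpr} → {τ : HLType} →
      (D : HLTyping Δ Γ e τ) → Prog.ClosedIn (ctxDom Δ Γ) D.compile
    | _, _, _, _, .unit | _, _, _, _, .tt | _, _, _, _, .ff => by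
        simp [HLTyping.compile, Prog.ClosedIn, Instr.ClosedIn, Val.ClosedIn]
    | _, _, _, _, .var h => by
        simp only [HLTyping.compile, Prog.ClosedIn, Instr.ClosedIn, Val.ClosedIn, and_true]
        exact Or.inl ⟨_, _, rfl, h⟩
    | _, _, _, _, .inl D | _, _, _, _, .inr D => by
        simp only [HLTyping.compile, Prog.closedIn_append]
        exact ⟨D.closedIn_compile, closedIn_tag _ _⟩
    | _, _, _, _, .pair D₁ D₂ => by
        simp [HLTyping.compile, Prog.closedIn_append, Prog.ClosedIn, closedIn_PAIR,
          D₁.closedIn_compile, D₂.closedIn_compile]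
    | _, _, _, _, .fst D | _, _, _, _, .snd D | _, _, _, _, .ref D | _, _, _, _, .deref D => by
        simp [HLTyping.compile, Prog.closedIn_append, Prog.ClosedIn, Instr.ClosedIn, Val.ClosedIn,
          D.closedIn_compile]
    | _, _, _, _, .ite D D₁ D₂ => by
        simp [HLTyping.compile, Prog.closedIn_append, Prog.ClosedIn, Instr.ClosedIn,
          D.closedIn_compile, D₁.closedIn_compile, D₂.closedIn_compile]
    | _, _, _, _, .lam D => by
        simp only [HLTyping.compile, Prog.ClosedIn, Instr.ClosedIn, Val.ClosedIn, and_true]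
        exact Prog.ClosedIn.mono (ctxDom_extend_hl _ _ _ _) _ D.closedIn_compile
    | _, _, _, _, .app D₁ D₂ => by
        simp [HLTyping.compile, Prog.closedIn_append, Prog.ClosedIn, closedIn_SWAP,
          Instr.ClosedIn, D₁.closedIn_compile, D₂.closedIn_compile]
    | _, _, _, _, .case D D₁ D₂ => by
        simp only [HLTyping.compile, Prog.closedIn_append, Prog.ClosedIn, Instr.ClosedIn, and_true]
        exact ⟨⟨D.closedIn_compile, closedIn_UNTAG _⟩,
          Prog.ClosedIn.mono (ctxDom_extend_hl _ _ _ _) _ D₁.closedIn_compile,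
          Prog.ClosedIn.mono (ctxDom_extend_hl _ _ _ _) _ D₂.closedIn_compile⟩
    | _, _, _, _, .assign D₁ D₂ => by
        simp [HLTyping.compile, Prog.closedIn_append, Prog.ClosedIn, Instr.ClosedIn, Val.ClosedIn,
          D₁.closedIn_compile, D₂.closedIn_compile]
    | _, _, _, _, .boundary D c => by
        simp only [HLTyping.compile, Prog.closedIn_append]
        exact ⟨D.closedIn_compile, c.closedIn_toHL _⟩
  theorem LLTyping.closedIn_compile : {Γ : HLCtx} → {Δ : LLCtx} → {e : LLExpr} → {τ : LLType} →
      (D : LLTyping Γ Δ e τ) → Prog.ClosedIn (ctxDom Δ Γ) D.compile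
    | _, _, _, _, .num => by
        simp [LLTyping.compile, Prog.ClosedIn, Instr.ClosedIn, Val.ClosedIn]
    | _, _, _, _, .var h => by
        simp only [LLTyping.compile, Prog.ClosedIn, Instr.ClosedIn, Val.ClosedIn, and_true]
        exact Or.inr ⟨_, _, rfl, h⟩
    | _, _, _, _, .arr Ds => by
        simp only [LLTyping.compile, Prog.closedIn_append]
        exact ⟨Ds.closedIn_compile, closedIn_mkArr _ _⟩
    | _, _, _, _, .idx D₁ D₂ | _, _, _, _, .app D₁ D₂ | _, _, _, _, .add D₁ D₂
    | _, _, _, _, .assign D₁ D₂ => by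
        simp [LLTyping.compile, Prog.closedIn_append, Prog.ClosedIn, Instr.ClosedIn, Val.ClosedIn,
          closedIn_SWAP, D₁.closedIn_compile, D₂.closedIn_compile]
    | _, _, _, _, .lam D => by
        simp only [LLTyping.compile, Prog.ClosedIn, Instr.ClosedIn, Val.ClosedIn, and_true]
        exact Prog.ClosedIn.mono (ctxDom_extend_ll _ _ _ _) _ D.closedIn_compile
    | _, _, _, _, .if0 D D₁ D₂ => by
        simp [LLTyping.compile, Prog.closedIn_append, Prog.ClosedIn, Instr.ClosedIn,
          D.closedIn_compile, D₁.closedIn_compile, D₂.closedIn_compile]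
    | _, _, _, _, .ref D | _, _, _, _, .deref D => by
        simp [LLTyping.compile, Prog.closedIn_append, Prog.ClosedIn, Instr.ClosedIn,
          D.closedIn_compile]
    | _, _, _, _, .boundary D c => by
        simp only [LLTyping.compile, Prog.closedIn_append]
        exact ⟨D.closedIn_compile, c.closedIn_toLL _⟩
  theorem LLTypings.closedIn_compile : {Γ : HLCtx} → {Δ : LLCtx} → {es : List LLExpr} →
      {τ : LLType} → (D : LLTypings Γ Δ es τ) → Prog.ClosedIn (ctxDom Δ Γ) D.compile
    | _, _, _, _, .nil => by simp [LLTypings.compile, Prog.ClosedIn]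
    | _, _, _, _, .cons D Ds => by
        simp only [LLTypings.compile, Prog.closedIn_append]
        exact ⟨D.closedIn_compile, Ds.closedIn_compile⟩
end

/-! ## The fundamental property -/

/-- The substitution `γ` maps the variables of both environments to values of their types. -/
structure EnvRel (k : ℕ) (Ψ : World) (Δ : LLCtx) (Γ : HLCtx) (γ : Env) : Prop where
  closed : γ.Closed
  hl : ∀ x τ, Γ x = some τ → ∃ v, γ (.hl x) = some v ∧ ValRel k τ.toTy Ψ v
  ll : ∀ x τ, Δ x = some τ → ∃ v, γ (.ll x) = some v ∧ ValRel k τ.toTy Ψ v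

theorem EnvRel.mono {k j Ψ Ψ' Δ Γ γ} (hj : j ≤ k) (hΨ : Ψ.Le Ψ') (h : EnvRel k Ψ Δ Γ γ) :
    EnvRel j Ψ' Δ Γ γ where
  closed := h.closed
  hl x τ hx := (h.hl x τ hx).imp fun _ hv => ⟨hv.1, hv.2.mono hj hΨ⟩
  ll x τ hx := (h.ll x τ hx).imp fun _ hv => ⟨hv.1, hv.2.mono hj hΨ⟩

theorem EnvRel.extend_hl {k Ψ Δ Γ γ w τ} (h : EnvRel k Ψ Δ Γ γ) (x : ℕ)
    (hw : ValRel k τ.toTy Ψ w) :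
    EnvRel k Ψ Δ (extend Γ x τ) (Function.update γ (.hl x) (some w)) where
  closed := h.closed.update_some _ hw.closed
  hl y σ hy := by
    by_cases hyx : y = x
    · subst hyx
      simp only [extend, Function.update_self, Option.some.injEq] at hy
      subst hy
      exact ⟨w, by simp, hw⟩
    · rw [extend, Function.update_of_ne hyx] at hy
      rw [Function.update_of_ne (by simpa using hyx)]
      exact h.hl y σ hy
  ll y σ hy := by
    rw [Function.update_of_ne (by simp)]
    exact h.ll y σ hy

theorem EnvRel.extend_ll {k Ψ Δ Γ γ w τ} (h : EnvRel k Ψ Δ Γ γ) (x : ℕ)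
    (hw : ValRel k τ.toTy Ψ w) :
    EnvRel k Ψ (extend Δ x τ) Γ (Function.update γ (.ll x) (some w)) where
  closed := h.closed.update_some _ hw.closed
  hl y σ hy := by
    rw [Function.update_of_ne (by simp)]
    exact h.hl y σ hy
  ll y σ hy := by
    by_cases hyx : y = x
    · subst hyx
      simp only [extend, Function.update_self, Option.some.injEq] at hy
      subst hy
      exact ⟨w, by simp, hw⟩
    · rw [extend, Function.update_of_ne hyx] at hy
      rw [Function.update_of_ne (by simpa using hyx)]
      exact h.ll y σ hy

theorem EnvRel.closed_msubst {k Ψ Δ Γ γ} (h : EnvRel k Ψ Δ Γ γ) {v : Val}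
    (hv : v.ClosedIn (ctxDom Δ Γ)) : (v.msubst γ).Closed := by
  refine Val.closedIn_msubst h.closed ?_ v hv
  rintro y (⟨x, τ, rfl, hx⟩ | ⟨x, τ, rfl, hx⟩) hn
  · obtain ⟨v, hv, _⟩ := h.hl x τ hx
    simp [hv] at hn
  · obtain ⟨v, hv, _⟩ := h.ll x τ hx
    simp [hv] at hn

/-- The program `P`, closed by a substitution for the given environments, behaves like a term of
type `T`. -/
def SemTyped (Δ : LLCtx) (Γ : HLCtx) (P : Prog) (T : Ty) : Prop :=
  ∀ ⦃k Ψ γ H S K⦄, EnvRel k Ψ Δ Γ γ → HeapRel k Ψ H → ContRel k T Ψ S K →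
    Safe k ⟨H, .ok S, Prog.msubst γ P ++ K⟩

-- Compatibility of semantic typing with the term formers

section Compatibility

variable {Δ : LLCtx} {Γ : HLCtx} {P P₁ P₂ : Prog} {T T₁ T₂ : Ty}

theorem ContRel.apply {k T Ψ S K H v} (h : ContRel k T Ψ S K) (hH : HeapRel k Ψ H)
    (hv : ValRel k T Ψ v) : Safe k ⟨H, .ok (v :: S), K⟩ :=
  h k le_rfl Ψ (.refl Ψ) H v hH hv

theorem SemTyped.num (n : ℤ) : SemTyped Δ Γ [.push (.num n)] .int :=
  fun _ _ _ _ _ _ _ hH hK => Safe.push_num (hK.apply hH (valRel_int.2 ⟨n, rfl⟩))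

/-- Sequencing with a closed program that consumes the value of the first one. -/
theorem SemTyped.bind {Q : Prog} (h : SemTyped Δ Γ P T₁) (hQ : Prog.ClosedIn ∅ Q)
    (hs : ∀ {k Ψ H S K v}, ValRel k T₁ Ψ v → HeapRel k Ψ H → ContRel k T Ψ S K →
      Safe k ⟨H, .ok (v :: S), Q ++ K⟩) : SemTyped Δ Γ (P ++ Q) T := by
  intro k Ψ γ H S K hγ hH hK
  rw [Prog.msubst_append, Prog.msubst_of_closed γ hQ, List.append_assoc]
  exact h hγ hH fun i hi Ψ' hΨ' H' v hH' hv => hs hv hH' (hK.mono hi hΨ')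

/-- Sequencing with a closed program that consumes the values of the first two. -/
theorem SemTyped.bind₂ {Q : Prog} (h₁ : SemTyped Δ Γ P₁ T₁) (h₂ : SemTyped Δ Γ P₂ T₂)
    (hQ : Prog.ClosedIn ∅ Q)
    (hs : ∀ {k Ψ H S K v w}, ValRel k T₁ Ψ v → ValRel k T₂ Ψ w → HeapRel k Ψ H →
      ContRel k T Ψ S K → Safe k ⟨H, .ok (w :: v :: S), Q ++ K⟩) :
    SemTyped Δ Γ (P₁ ++ P₂ ++ Q) T := by
  intro k Ψ γ H S K hγ hH hK
  rw [Prog.msubst_append, Prog.msubst_append, Prog.msubst_of_closed γ hQ, List.append_assoc,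
    List.append_assoc]
  refine h₁ hγ hH fun i hi Ψ' hΨ' H' v hH' hv => ?_
  refine h₂ (hγ.mono hi hΨ') hH' fun j hj Ψ'' hΨ'' H'' w hH'' hw => ?_
  -- The first value must survive the evaluation of the second program, which may have allocated.
  exact hs (hv.mono hj hΨ'') hw hH'' (hK.mono (hj.trans hi) (hΨ'.trans hΨ''))

theorem SemTyped.app (h₁ : SemTyped Δ Γ P₁ (.fn T₁ T)) (h₂ : SemTyped Δ Γ P₂ T₁) :
    SemTyped Δ Γ (P₁ ++ P₂ ++ [SWAP, .call]) T :=
  h₁.bind₂ h₂ (by simp [Prog.ClosedIn, closedIn_SWAP, Instr.ClosedIn]) fun hv hw hH hK =>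
    Safe.swap hw.closed hv.closed (hv.call hw hH hK)

/-- `SemTyped.bind` does not apply, because the branches are open programs. -/
theorem SemTyped.if0 (h : SemTyped Δ Γ P .int) (h₁ : SemTyped Δ Γ P₁ T)
    (h₂ : SemTyped Δ Γ P₂ T) : SemTyped Δ Γ (P ++ [.if0 P₁ P₂]) T := by
  intro k Ψ γ H S K hγ hH hK
  rw [Prog.msubst_append, List.append_assoc]
  refine h hγ hH fun i hi Ψ' hΨ' H' v hH' hv => ?_
  obtain ⟨n, rfl⟩ := valRel_int.1 hv
  simp only [Prog.msubst, Instr.msubst, List.cons_append, List.nil_append]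
  exact Safe.if0 (fun _ => h₁ (hγ.mono hi hΨ') hH' (hK.mono hi hΨ'))
    (fun _ => h₂ (hγ.mono hi hΨ') hH' (hK.mono hi hΨ'))

theorem SemTyped.ref (h : SemTyped Δ Γ P T) : SemTyped Δ Γ (P ++ [.alloc]) (.ref T) :=
  h.bind (by simp [Prog.ClosedIn, Instr.ClosedIn]) fun hv hH hK =>
    Safe.alloc fun l hl => by
      obtain ⟨hle, hH'⟩ := hH.alloc hl hv
      exact hK _ le_rfl _ hle _ _ hH' (valRel_ref.2 ⟨l, rfl, by simp⟩)

theorem SemTyped.deref (h : SemTyped Δ Γ P (.ref T)) : SemTyped Δ Γ (P ++ [.read]) T :=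
  h.bind (by simp [Prog.ClosedIn, Instr.ClosedIn]) fun hv hH hK => by
    obtain ⟨l, rfl, hl⟩ := valRel_ref.1 hv
    obtain ⟨u, hu, hu'⟩ := hH l _ hl
    exact Safe.read hu (hK.apply hH hu')

theorem SemTyped.assign (h₁ : SemTyped Δ Γ P₁ (.ref T)) (h₂ : SemTyped Δ Γ P₂ T) :
    SemTyped Δ Γ (P₁ ++ P₂ ++ [.write, .push (.num 0)]) .int :=
  h₁.bind₂ h₂ (by simp [Prog.ClosedIn, Instr.ClosedIn, Val.ClosedIn]) fun hv hw hH hK => by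
    obtain ⟨l, rfl, hl⟩ := valRel_ref.1 hv
    obtain ⟨u, hu, _⟩ := hH l _ hl
    exact Safe.write (Finmap.mem_of_lookup_eq_some hu) <| Safe.push_num <|
      hK.apply (hH.insert hl hw) (valRel_int.2 ⟨0, rfl⟩)

/-- The body is described through the updated substitution instead of an extended environment, so
that the lemma serves the variables of both languages. -/
theorem SemTyped.lam {x : TVar} (hc : (Val.thunk [.lam x P]).ClosedIn (ctxDom Δ Γ))
    (h : ∀ {k Ψ γ w H S K}, EnvRel k Ψ Δ Γ γ → ValRel k T₁ Ψ w → HeapRel k Ψ H →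
      ContRel k T₂ Ψ S K → Safe k ⟨H, .ok S, Prog.msubst (Function.update γ x (some w)) P ++ K⟩) :
    SemTyped Δ Γ [.push (.thunk [.lam x P])] (.fn T₁ T₂) := by
  intro k Ψ γ H S K hγ hH hK
  have hcl := hγ.closed_msubst hc
  refine Safe.push hcl (hK.apply hH (valRel_fn.2 ⟨_, by rw [Val.msubst], hcl, ?_⟩))
  intro j hj Ψ' hΨ' w H' S' K' hw hH' hK'
  simp only [Prog.msubst, Instr.msubst, List.cons_append, List.nil_append]
  refine Safe.lam ?_
  rw [Prog.subst_msubst_update hγ.closed]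
  exact h (hγ.mono hj.le hΨ') hw hH' hK'

theorem SemTyped.case {x y : ℕ} {τ₁ τ₂ : HLType} (h : SemTyped Δ Γ P (.sum τ₁.toTy τ₂.toTy))
    (h₁ : SemTyped Δ (extend Γ x τ₁) P₁ T) (h₂ : SemTyped Δ (extend Γ y τ₂) P₂ T) :
    SemTyped Δ Γ (P ++ UNTAG ++ [.if0 [.lam (.hl x) P₁] [.lam (.hl y) P₂]]) T := by
  intro k Ψ γ H S K hγ hH hK
  rw [Prog.msubst_append, Prog.msubst_append, Prog.msubst_of_closed γ (closedIn_UNTAG ∅),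
    List.append_assoc, List.append_assoc]
  refine h hγ hH fun i hi Ψ' hΨ' H' v hH' hv => ?_
  have hc := hv.closed
  have hγ' := hγ.mono hi hΨ'
  simp only [Prog.msubst, Instr.msubst, List.cons_append, List.nil_append]
  obtain ⟨w, ⟨rfl, hw⟩ | ⟨rfl, hw⟩⟩ := valRel_sum.1 hv
  · refine Safe.untag hc <| Safe.if0 (fun _ => Safe.lam ?_) (fun h => absurd rfl h)
    rw [Prog.subst_msubst_update hγ.closed]
    exact h₁ (hγ'.extend_hl x hw) hH' (hK.mono hi hΨ')
  · refine Safe.untag hc <| Safe.if0 (fun h => absurd h one_ne_zero) (fun _ => Safe.lam ?_)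
    rw [Prog.subst_msubst_update hγ.closed]
    exact h₂ (hγ'.extend_hl y hw) hH' (hK.mono hi hΨ')

end Compatibility

mutual
  -- The induction is mutual because boundaries switch languages. At a boundary the embedded program
  -- is good at its own type, and the glue code carries its value to the other type.
  theorem HLTyping.sound : {Δ : LLCtx} → {Γ : HLCtx} → {e : HLExpr} → {τ : HLType} →
      (D : HLTyping Δ Γ e τ) → SemTyped Δ Γ D.compile τ.toTy
    | _, _, _, _, .unit => SemTyped.num 0
    | _, _, _, _, .tt => SemTyped.num 0
    | _, _, _, _, .ff => SemTyped.num 1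
    | _, _, _, _, .var h => by
        intro k Ψ γ H S K hγ hH hK
        obtain ⟨v, hv, hr⟩ := hγ.hl _ _ h
        simp only [HLTyping.compile, Prog.msubst, Instr.msubst, Val.msubst, hv, Option.getD_some]
        exact Safe.push hr.closed (hK.apply hH hr)
    | _, _, _, _, .inl D => by
        rw [HLTyping.compile]
        exact D.sound.bind (closedIn_tag _ _) fun hv hH hK =>
          Safe.tag hv.closed (hK.apply hH (valRel_sum.2 ⟨_, Or.inl ⟨rfl, hv⟩⟩))
    | _, _, _, _, .inr D => by
        rw [HLTyping.compile]
        exact D.sound.bind (closedIn_tag _ _) fun hv hH hK =>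
          Safe.tag hv.closed (hK.apply hH (valRel_sum.2 ⟨_, Or.inr ⟨rfl, hv⟩⟩))
    | _, _, _, _, .pair D₁ D₂ => by
        rw [HLTyping.compile]
        exact D₁.sound.bind₂ D₂.sound (by simp [Prog.ClosedIn, closedIn_PAIR]) fun hv hw hH hK =>
          Safe.pair hv.closed hw.closed (hK.apply hH (valRel_prod.2 ⟨_, _, rfl, hv, hw⟩))
    | _, _, _, _, .fst D => by
        rw [HLTyping.compile]
        refine D.sound.bind (by simp [Prog.ClosedIn, Instr.ClosedIn, Val.ClosedIn])
          fun hv hH hK => ?_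
        obtain ⟨w₁, w₂, rfl, h₁, _⟩ := valRel_prod.1 hv
        exact Safe.push_num (Safe.idx_zero (hK.apply hH h₁))
    | _, _, _, _, .snd D => by
        rw [HLTyping.compile]
        refine D.sound.bind (by simp [Prog.ClosedIn, Instr.ClosedIn, Val.ClosedIn])
          fun hv hH hK => ?_
        obtain ⟨w₁, w₂, rfl, _, h₂⟩ := valRel_prod.1 hv
        exact Safe.push_num (Safe.idx_one (hK.apply hH h₂))
    | _, _, _, _, .ite D D₁ D₂ => by
        rw [HLTyping.compile]; exact D.sound.if0 D₁.sound D₂.sound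
    | _, _, _, _, .lam D => by
        have hc := (HLTyping.lam D).closedIn_compile
        rw [HLTyping.compile] at hc ⊢
        exact SemTyped.lam hc.1 fun hγ hw hH hK => D.sound (hγ.extend_hl _ hw) hH hK
    | _, _, _, _, .app D₁ D₂ => by
        rw [HLTyping.compile]; exact D₁.sound.app D₂.sound
    | _, _, _, _, .case D D₁ D₂ => by
        rw [HLTyping.compile]; exact D.sound.case D₁.sound D₂.sound
    | _, _, _, _, .ref D => by
        rw [HLTyping.compile]; exact D.sound.ref
    | _, _, _, _, .deref D => by
        rw [HLTyping.compile]; exact D.sound.deref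
    | _, _, _, _, .assign D₁ D₂ => by
        rw [HLTyping.compile]; exact D₁.sound.assign D₂.sound
    | _, _, _, _, .boundary D c => by
        rw [HLTyping.compile]
        exact D.sound.bind (c.closedIn_toHL _) fun hv hH hK =>
          c.safe_toHL hv fun _ hv' => hK.apply hH hv'
  theorem LLTyping.sound : {Γ : HLCtx} → {Δ : LLCtx} → {e : LLExpr} → {τ : LLType} →
      (D : LLTyping Γ Δ e τ) → SemTyped Δ Γ D.compile τ.toTy
    | _, _, _, _, .num => SemTyped.num _
    | _, _, _, _, .var h => by
        intro k Ψ γ H S K hγ hH hK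
        obtain ⟨v, hv, hr⟩ := hγ.ll _ _ h
        simp only [LLTyping.compile, Prog.msubst, Instr.msubst, Val.msubst, hv, Option.getD_some]
        exact Safe.push hr.closed (hK.apply hH hr)
    | _, _, _, _, .arr (es := es) Ds => by
        intro k Ψ γ H S K hγ hH hK
        rw [LLTyping.compile, Prog.msubst_append, Prog.msubst_of_closed γ (closedIn_mkArr _ _),
          List.append_assoc]
        refine Ds.sound hγ hH fun i hi Ψ' hΨ' H' vs hH' hlen hvs => ?_
        rw [← hlen]
        exact Safe.mkArr (fun v hv => (hvs v hv).closed)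
          (hK i hi Ψ' hΨ' H' _ hH' (valRel_arr.2 ⟨vs, rfl, hvs⟩))
    | _, _, _, _, .idx D₁ D₂ => by
        rw [LLTyping.compile]
        refine D₁.sound.bind₂ D₂.sound (by simp [Prog.ClosedIn, Instr.ClosedIn])
          fun hv hw hH hK => ?_
        obtain ⟨vs, rfl, hvs⟩ := valRel_arr.1 hv
        obtain ⟨n, rfl⟩ := valRel_int.1 hw
        exact Safe.idx fun u hu _ _ => hK.apply hH (hvs u hu)
    | _, _, _, _, .lam D => by
        have hc := (LLTyping.lam D).closedIn_compile
        rw [LLTyping.compile] at hc ⊢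
        exact SemTyped.lam hc.1 fun hγ hw hH hK => D.sound (hγ.extend_ll _ hw) hH hK
    | _, _, _, _, .app D₁ D₂ => by
        rw [LLTyping.compile]; exact D₁.sound.app D₂.sound
    | _, _, _, _, .add D₁ D₂ => by
        rw [LLTyping.compile]
        refine D₁.sound.bind₂ D₂.sound (by simp [Prog.ClosedIn, Instr.ClosedIn, closedIn_SWAP])
          fun hv hw hH hK => ?_
        obtain ⟨n, rfl⟩ := valRel_int.1 hv
        obtain ⟨m, rfl⟩ := valRel_int.1 hw
        exact Safe.swap (Val.closed_num _) (Val.closed_num _) <| Safe.add <|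
          hK.apply hH (valRel_int.2 ⟨_, rfl⟩)
    | _, _, _, _, .if0 D D₁ D₂ => by
        rw [LLTyping.compile]; exact D.sound.if0 D₁.sound D₂.sound
    | _, _, _, _, .ref D => by
        rw [LLTyping.compile]; exact D.sound.ref
    | _, _, _, _, .deref D => by
        rw [LLTyping.compile]; exact D.sound.deref
    | _, _, _, _, .assign D₁ D₂ => by
        rw [LLTyping.compile]; exact D₁.sound.assign D₂.sound
    | _, _, _, _, .boundary D c => by
        rw [LLTyping.compile]
        exact D.sound.bind (c.closedIn_toLL _) fun hv hH hK =>
          c.safe_toLL hv fun _ hv' => hK.apply hH hv'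
  /-- The entries of an array literal leave their values on the stack, the last one on top. -/
  theorem LLTypings.sound : {Γ : HLCtx} → {Δ : LLCtx} → {es : List LLExpr} → {τ : LLType} →
      (D : LLTypings Γ Δ es τ) → ∀ ⦃k Ψ γ H S K⦄, EnvRel k Ψ Δ Γ γ → HeapRel k Ψ H →
        (∀ i, i ≤ k → ∀ Ψ', Ψ.Le Ψ' → ∀ H' (vs : List Val), HeapRel i Ψ' H' →
          vs.length = es.length → (∀ v ∈ vs, ValRel i τ.toTy Ψ' v) →
          Safe i ⟨H', .ok (vs.reverse ++ S), K⟩) →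
        Safe k ⟨H, .ok S, Prog.msubst γ D.compile ++ K⟩
    | _, _, _, _, .nil => by
        intro k Ψ γ H S K _ hH hK
        exact hK k le_rfl Ψ (.refl Ψ) H [] hH rfl (by simp)
    | _, _, _, _, .cons D Ds => by
        intro k Ψ γ H S K hγ hH hK
        rw [LLTypings.compile, Prog.msubst_append, List.append_assoc]
        refine D.sound hγ hH fun i hi Ψ' hΨ' H' v hH' hv => ?_
        refine Ds.sound (hγ.mono hi hΨ') hH' fun j hj Ψ'' hΨ'' H'' vs hH'' hlen hvs => ?_
        -- The reverse of `v :: vs` puts `v` directly on `S`, below the values of the later entries.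
        have := hK j (hj.trans hi) Ψ'' (hΨ'.trans hΨ'') H'' (v :: vs) hH'' (by simp [hlen])
          (by simpa using ⟨hv.mono hj hΨ'', hvs⟩)
        simpa using this
end

/-- Compiled closed programs are safe. -/
theorem HLTyping.safe {e : HLExpr} {τ : HLType}
    (D : HLTyping (fun _ => none) (fun _ => none) e τ) (H : Heap) (k : ℕ) :
    Safe k ⟨H, .ok [], D.compile⟩ := by
  have hγ : EnvRel k (fun _ => none) (fun _ => none) (fun _ => none) (fun _ => none) :=
    ⟨fun _ _ h => (nomatch h), fun _ _ h => (nomatch h), fun _ _ h => (nomatch h)⟩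
  -- The empty world constrains no location, so the initial heap is arbitrary.
  have hH : HeapRel k (fun _ => none) H := by intro l T h; cases h
  have hK : ContRel k τ.toTy (fun _ => none) [] [] := by
    intro i _ Ψ' _ H' v _ hv
    cases i with
    | zero => trivial
    | succ i =>
      refine ⟨Or.inl ⟨rfl, Or.inr ⟨v, hv.closed, rfl⟩⟩, fun c' hc' => ?_⟩
      cases hc'
  have := D.sound hγ hH hK
  rwa [List.append_nil, Prog.msubst_of_closedIn (fun _ _ => rfl) _ D.closedIn_compile] at this

end RefLang

/-- Type safety for RefHL. `D` is a derivation of `·; · ⊢ e : τ`, and `D.compile` is the compiled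
program of `e`. -/
theorem theorem3p4 {e : RefLang.HLExpr} {τ : RefLang.HLType}
    (D : RefLang.HLTyping (fun _ => none) (fun _ => none) e τ)
    (H H' : RefLang.Heap) (S' : RefLang.Stack) (P' : RefLang.Prog)
    (hreach : RefLang.Steps ⟨H, .ok [], D.compile⟩ ⟨H', S', P'⟩) :
    (∃ H'' S'' P'', RefLang.Step ⟨H', S', P'⟩ ⟨H'', S'', P''⟩) ∨
      (P' = [] ∧
        ((∃ c : RefLang.Err, (c = .convErr ∨ c = .idxErr) ∧ S' = .fail c) ∨
          (∃ v : RefLang.Val, v.Closed ∧ S' = .ok [v]))) := by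
  rcases RefLang.Safe.of_steps (D.safe H) hreach with hfin | ⟨⟨H'', S'', P''⟩, hstep⟩
  · exact Or.inr hfin
  · exact Or.inl ⟨H'', S'', P'', hstep⟩
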